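/- Let $n\ge 0$. A virtual $n$-string link diagram is a generic collection of $n$ immersed strings in the strip $\mathbb R\times[0,1]$, the $i$-th one an oriented path from $(i,1)$ to $(\pi(i),0)$ for a permutation $\pi$ of $\{1,\dots,n\}$, with finitely many transverse double points, each marked as a real crossing (with over/under information) or as a virtual crossing; diagrams are considered up to planar isotopy of the strip fixing the end points. Virtual $n$-string links are the equivalence classes of diagrams under the generalized Reidemeister moves: the real moves $\Omega_1,\Omega_2,\Omega_3$, the virtual moves $\Omega_1',\Omega_2',\Omega_3'$ (the same moves with all crossings virtual) and the mixed move $\Omega_3^s$ (a strand with two consecutive virtual crossings moves across a real crossing), each for all orientations. They form a monoid: $L\cdot L'$ is obtained by placing $L$ on top of $L'$. A ball starts at $(i,1)$ and follows the strings along their orientation. At each crossing it either keeps walking on its lane or jumps to the other lane (and then follows the orientation of that lane). In general it jumps with weight $1-t$ (resp. $1-u$) when it comes to a negative crossing on the upper (resp. lower) lane, with weight $1-v$ (resp. $1-w$) when it comes to a positive crossing on the upper (resp. lower) lane, and with weight $s$ (resp. $r$) when it comes to a virtual crossing from the left (resp. right), where the crossing is viewed with both lanes directed downwards; it keeps walking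 with weight $1$ minus the weight of jumping. The weight of a path is the product of the weights of the choices made along it. Take $u=w=t=v=1$ and $r=-s$, with $s$ the class of the variable in $\mathbb Z[s]/(s^2)$, and let $M(L)$ be the $n\times n$ matrix over $\mathbb Z[s]/(s^2)$ whose $(i,j)$ entry is the sum of the weights of all paths from $(i,1)$ to $(j,0)$ in the diagram $L$. **Theorem 2.1.** For every virtual $n$-string link diagram $L$: 1. For all $i,j$ only finitely many paths from $(i,1)$ to $(j,0)$ have non-zero weight, so that $M(L)$ is well defined, and each entry of $M(L)$ has the form $as+b$ with $a\in\mathbb Z$ and $b\in\{0,1\}$. 2. $M(L)$ is invariant under planar isotopy and the generalized Reidemeister moves. Moreover $M$ induces a representation of the monoid of virtual $n$-string links, that is, a monoid homomorphism from it to the $n\times n$ matrices over $\mathbb Z[s]/(s^2)$. -/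

import Mathlib

open Polynomial

namespace VStringLink

/-! ### Oriented tangle diagrams in the strip

A diagram in `ℝ × [0, 1]` that is generic for the height function is read from top to bottom as a
finite sequence of horizontal slices. Each slice contains one crossing, one local minimum or one
local maximum, next to vertical strands. Every generic immersed diagram is planar isotopic to such
a one; planar isotopy is generated by the isotopy moves listed further below. -/

/-- The direction of travel of a strand at a horizontal level. -/
inductive Dir
  | down
  | up
  deriving DecidableEq

/-- The opposite direction. -/
def Dir.rev : Dir → Dir
  | .down => .up
  | .up => .down

/-- The kinds of crossing, for a crossing drawn as `X`: its first strand is `\` (from top left to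
bottom right), its second strand is `/` (from top right to bottom left). In `real firstOver` the
first strand is the upper one if `firstOver = true`, and the lower one otherwise. -/
inductive Crossing
  | real (firstOver : Bool)
  | virtual
  deriving DecidableEq

/-- The crossing with the roles of the two strands `\` and `/` exchanged. -/
def Crossing.swap : Crossing → Crossing
  | .real b => .real (!b)
  | .virtual => .virtual

/-- Elementary oriented tangles. `cross c x y`: a crossing whose first strand `\` has direction `x`
and whose second strand `/` has direction `y`. `cup x`: a local minimum `∪` whose left end has
direction `x`. `cap x`: a local maximum `∩` whose left end has direction `x`. -/
inductive Elem
  | cross (c : Crossing) (x y : Dir)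
  | cup (x : Dir)
  | cap (x : Dir)

/-- Directions at the upper end points, from left to right. -/
def Elem.dom : Elem → List Dir
  | .cross _ x y => [x, y]
  | .cup x => [x, x.rev]
  | .cap _ => []

/-- Directions at the lower end points, from left to right. -/
def Elem.cod : Elem → List Dir
  | .cross _ x y => [y, x]
  | .cup _ => []
  | .cap x => [x, x.rev]

/-- A horizontal slice: vertical strands with the directions `left`, then an elementary tangle,
then vertical strands with the directions `right`. -/
structure Slice where
  left : List Dir
  elem : Elem
  right : List Dir

/-- Directions at the top of the slice. -/
def Slice.dom (σ : Slice) : List Dir := σ.left ++ σ.elem.dom ++ σ.right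

/-- Directions at the bottom of the slice. -/
def Slice.cod (σ : Slice) : List Dir := σ.left ++ σ.elem.cod ++ σ.right

/-- The slices of `w` fit together to an oriented tangle diagram from `o` (top) to `o'` (bottom). -/
def IsTangle : List Dir → List Slice → List Dir → Prop
  | o, [], o' => o = o'
  | o, σ :: w, o' => o = σ.dom ∧ IsTangle σ.cod w o'

/-- An end point of a strand of a slice: the `k`-th one (counted from `0`, from the left) at the
top, or at the bottom. -/
inductive Port
  | top (k : ℕ)
  | bot (k : ℕ)
  deriving DecidableEq

/-- A strand of a diagram at a level: `(t, k)` is the `k`-th strand at the level between slice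
`t - 1` and slice `t`. Level `0` is the top of the diagram. -/
abbrev Point := ℕ × ℕ

/-- The position in the diagram of a port of the slice number `t`. -/
def Port.place (t : ℕ) : Port → Point
  | .top k => (t, k)
  | .bot k => (t + 1, k)

/-- The arc joining `p` and `q`, as the pair (start, end): it goes from `p` to `q` for `down` and
from `q` to `p` for `up`. -/
def Dir.arc : Dir → Port → Port → Port × Port
  | .down, p, q => (p, q)
  | .up, p, q => (q, p)

/-- The first strand `\` of a crossing with `a` strands to the left of it. -/
def firstStrand (a : ℕ) (x : Dir) : Port × Port := x.arc (.top a) (.bot (a + 1))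

/-- The second strand `/` of a crossing with `a` strands to the left of it. -/
def secondStrand (a : ℕ) (y : Dir) : Port × Port := y.arc (.top (a + 1)) (.bot a)

/-- The oriented arcs of an elementary tangle with `a` strands to the left of it. -/
def Elem.arcs (a : ℕ) : Elem → List (Port × Port)
  | .cross _ x y => [firstStrand a x, secondStrand a y]
  | .cup x => [x.arc (.top a) (.top (a + 1))]
  | .cap x => [x.arc (.bot (a + 1)) (.bot a)]

/-- The oriented vertical strands of a slice. -/
def Slice.sideArcs (σ : Slice) : List (Port × Port) :=
  σ.left.mapIdx (fun k d => d.arc (.top k) (.bot k)) ++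
    σ.right.mapIdx (fun k d => d.arc (.top (σ.left.length + σ.elem.dom.length + k))
      (.bot (σ.left.length + σ.elem.cod.length + k)))

/-- All oriented arcs of a slice, each passing straight through the crossing, if there is one. -/
def Slice.arcs (σ : Slice) : List (Port × Port) := σ.sideArcs ++ σ.elem.arcs σ.left.length

/-- Following a strand, without ever changing lanes, through one slice. -/
def StraightStep (w : List Slice) (p q : Point) : Prop :=
  ∃ (t : ℕ) (σ : Slice), w[t]? = some σ ∧ ∃ a ∈ σ.arcs, p = a.1.place t ∧ q = a.2.place t

/-- `(t, k)` is a strand of the diagram `w`, where `o` is the top boundary. -/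
def IsPoint (o : List Dir) (w : List Slice) (p : Point) : Prop :=
  ∃ l, (o :: w.map Slice.cod)[p.1]? = some l ∧ p.2 < l.length

/-- The boundary of a string link with `n` strings: all strands run downwards. -/
def strings (n : ℕ) : List Dir := List.replicate n Dir.down

/-- Virtual `n`-string link diagrams: oriented diagrams with real and virtual crossings from `n`
downward strands to `n` downward strands, where every piece of the diagram lies on a string that
starts at the top. (Orientations then force the string to end at the bottom.) Thus the diagram
consists of `n` strings and has no closed component. -/
@[ext]
structure Diagram (n : ℕ) where
  word : List Slice
  isTangle : IsTangle (strings n) word (strings n)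
  noClosed : ∀ p, IsPoint (strings n) word p →
    ∃ i < n, Relation.ReflTransGen (StraightStep word) (0, i) p

/-! ### Composition of diagrams -/

theorem IsTangle.append {o o' o'' : List Dir} {w w' : List Slice} (h : IsTangle o w o')
    (h' : IsTangle o' w' o'') : IsTangle o (w ++ w') o'' := by
  induction w generalizing o with
  | nil => cases h; exact h'
  | cons σ w ih => exact ⟨h.1, ih h.2⟩

theorem IsTangle.last {o o' : List Dir} {w : List Slice} (h : IsTangle o w o') :
    (o :: w.map Slice.cod)[w.length]? = some o' := by
  induction w generalizing o with
  | nil => cases h; rfl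
  | cons σ w ih => simpa using ih h.2

theorem StraightStep.append_right {w : List Slice} (w' : List Slice) {p q : Point}
    (h : StraightStep w p q) : StraightStep (w ++ w') p q := by
  obtain ⟨t, σ, ht, h⟩ := h
  refine ⟨t, σ, ?_, h⟩
  rw [List.getElem?_append_left (List.getElem?_eq_some_iff.1 ht).1, ht]

theorem StraightStep.append_left (w : List Slice) {w' : List Slice} {p q : Point}
    (h : StraightStep w' p q) :
    StraightStep (w ++ w') (w.length + p.1, p.2) (w.length + q.1, q.2) := by
  obtain ⟨t, σ, ht, a, ha, rfl, rfl⟩ := h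
  refine ⟨w.length + t, σ, ?_, a, ha, ?_, ?_⟩
  · rw [List.getElem?_append_right (by omega)]
    simpa using ht
  · cases a.1 <;> simp [Port.place, add_assoc]
  · cases a.2 <;> simp [Port.place, add_assoc]

/-- The trivial string link diagram. -/
instance (n : ℕ) : One (Diagram n) where
  one :=
    { word := []
      isTangle := rfl
      noClosed := by
        rintro ⟨t, k⟩ ⟨l, hl, hk⟩
        cases t with
        | zero =>
          simp only [List.map_nil, List.getElem?_cons_zero, Option.some.injEq] at hl
          subst hl
          exact ⟨k, by simpa [strings] using hk, .refl⟩
        | succ t => simp at hl }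

/-- `D * D'` is the diagram with `D` placed on top of `D'`. -/
instance (n : ℕ) : Mul (Diagram n) where
  mul D D' :=
    { word := D.word ++ D'.word
      isTangle := D.isTangle.append D'.isTangle
      noClosed := by
        have key : ∀ p, IsPoint (strings n) D.word p →
            ∃ i < n, Relation.ReflTransGen (StraightStep (D.word ++ D'.word)) (0, i) p := by
          intro p hp
          obtain ⟨i, hi, h⟩ := D.noClosed p hp
          exact ⟨i, hi, Relation.ReflTransGen.mono
            (fun a b hab => StraightStep.append_right D'.word hab) _ _ h⟩
        rintro ⟨t, k⟩ ⟨l, hl, hk⟩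
        rw [List.map_append, ← List.cons_append] at hl
        by_cases ht : t < D.word.length + 1
        · rw [List.getElem?_append_left (by simpa using ht)] at hl
          exact key _ ⟨l, hl, hk⟩
        · obtain ⟨m, rfl⟩ : ∃ m, t = D.word.length + (m + 1) :=
            ⟨t - D.word.length - 1, by omega⟩
          rw [List.getElem?_append_right (by simp)] at hl
          have hl' : (strings n :: D'.word.map Slice.cod)[m + 1]? = some l := by
            rw [← hl]; simp; congr 2; omega
          obtain ⟨i, hi, h⟩ := D'.noClosed (m + 1, k) ⟨l, hl', hk⟩
          obtain ⟨i₀, hi₀, h₀⟩ := key (D.word.length, i)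
            ⟨strings n, D.isTangle.last, by simpa [strings] using hi⟩
          exact ⟨i₀, hi₀, h₀.trans (Relation.ReflTransGen.lift
            (fun q : Point => (D.word.length + q.1, q.2))
            (fun _ _ hab => StraightStep.append_left _ hab) _ _ h)⟩ }

@[simp] theorem Diagram.word_one (n : ℕ) : (1 : Diagram n).word = [] := rfl

@[simp] theorem Diagram.word_mul {n : ℕ} (D D' : Diagram n) :
    (D * D').word = D.word ++ D'.word := rfl

instance (n : ℕ) : Monoid (Diagram n) where
  mul_assoc D D' D'' := by ext1; simp
  one_mul D := by ext1; simp
  mul_one D := by ext1; simp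

/-! ### Generalized Reidemeister moves -/

/-- The kinds of crossing admitted in a move of a triangle, formed by three strands that start in
the order `A`, `B`, `C` at the top, where `c₁`, `c₂`, `c₃` are the crossings of `A` with `B`,
of `A` with `C` and of `B` with `C`. -/
inductive TriangleKind : Crossing → Crossing → Crossing → Prop
  /-- Three real crossings, such that one strand is on top, one in the middle, one at the bottom:
  the two cyclic patterns are excluded. -/
  | real (a b c : Bool) (h : ¬ (a = c ∧ a ≠ b)) : TriangleKind (.real a) (.real b) (.real c)
  /-- Three virtual crossings. -/
  | virtual : TriangleKind .virtual .virtual .virtual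
  /-- Two virtual crossings and a real one: a strand moves across a real crossing virtually. -/
  | mixed₁ (a : Bool) : TriangleKind (.real a) .virtual .virtual
  | mixed₂ (a : Bool) : TriangleKind .virtual (.real a) .virtual
  | mixed₃ (a : Bool) : TriangleKind .virtual .virtual (.real a)

/-- The moves inside a disc, for all orientations of the strands: the moves of planar isotopy, then
the generalized Reidemeister moves. -/
inductive LocalMove : List Slice → List Slice → Prop
  /-- Planar isotopy: exchanging the heights of two distant elementary tangles. -/
  | commute (e₁ e₂ : Elem) (m : List Dir) :
      LocalMove [⟨[], e₁, m ++ e₂.dom⟩, ⟨e₁.cod ++ m, e₂, []⟩]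
        [⟨e₁.dom ++ m, e₂, []⟩, ⟨[], e₁, m ++ e₂.cod⟩]
  /-- Planar isotopy: straightening a zigzag. -/
  | zigzag_right (x : Dir) :
      LocalMove [⟨[x], .cap x.rev, []⟩, ⟨[], .cup x, [x]⟩] []
  | zigzag_left (x : Dir) :
      LocalMove [⟨[], .cap x, [x]⟩, ⟨[x], .cup x.rev, []⟩] []
  /-- Planar isotopy: a strand `z` slides over the top of a maximum that it crosses. -/
  | slide_cap (c : Crossing) (x z : Dir) :
      LocalMove [⟨[], .cap x, [z]⟩, ⟨[x], .cross c x.rev z, []⟩]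
        [⟨[z], .cap x, []⟩, ⟨[], .cross c.swap z x, [x.rev]⟩]
  /-- Planar isotopy: a strand `z` slides over the bottom of a minimum that it crosses. -/
  | slide_cup (c : Crossing) (x z : Dir) :
      LocalMove [⟨[x], .cross c z x.rev, []⟩, ⟨[], .cup x, [z]⟩]
        [⟨[], .cross c.swap x z, [x.rev]⟩, ⟨[z], .cup x, []⟩]
  /-- First move, real or virtual, with the kink on the right or on the left. -/
  | kink_right (c : Crossing) (x : Dir) :
      LocalMove [⟨[x], .cap x, []⟩, ⟨[], .cross c x x, [x.rev]⟩, ⟨[x], .cup x, []⟩] []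
  | kink_left (c : Crossing) (x : Dir) :
      LocalMove [⟨[], .cap x.rev, [x]⟩, ⟨[x.rev], .cross c x x, []⟩, ⟨[], .cup x.rev, [x]⟩] []
  /-- Second move, real (one strand lies above the other) or virtual. -/
  | bigon (c : Crossing) (x y : Dir) :
      LocalMove [⟨[], .cross c x y, []⟩, ⟨[], .cross c.swap y x, []⟩] []
  /-- Third move: real, virtual or mixed. -/
  | triangle (c₁ c₂ c₃ : Crossing) (h : TriangleKind c₁ c₂ c₃) (x y z : Dir) :
      LocalMove [⟨[], .cross c₁ x y, [z]⟩, ⟨[y], .cross c₂ x z, []⟩, ⟨[], .cross c₃ y z, [x]⟩]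
        [⟨[x], .cross c₃ y z, []⟩, ⟨[], .cross c₂ x z, [y]⟩, ⟨[z], .cross c₁ x y, []⟩]

/-- Adding vertical strands on both sides of a slice. -/
def Slice.pad (a b : List Dir) (σ : Slice) : Slice := ⟨a ++ σ.left, σ.elem, σ.right ++ b⟩

/-- `D'` results from `D` when the part of `D` inside a disc is changed by one of the moves. -/
def Move {n : ℕ} (D D' : Diagram n) : Prop :=
  ∃ (w w' l l' : List Slice) (a b : List Dir), LocalMove l l' ∧
    D.word = w ++ l.map (Slice.pad a b) ++ w' ∧ D'.word = w ++ l'.map (Slice.pad a b) ++ w'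

theorem Move.mul {n : ℕ} (E : Diagram n) {D D' : Diagram n} (h : Move D D') (F : Diagram n) :
    Move (E * D * F) (E * D' * F) := by
  obtain ⟨w, w', l, l', a, b, hl, h, h'⟩ := h
  exact ⟨E.word ++ w, w' ++ F.word, l, l', a, b, hl, by simp [h], by simp [h']⟩

theorem eqvGen_mul {n : ℕ} (E : Diagram n) {D D' : Diagram n} (h : Relation.EqvGen Move D D')
    (F : Diagram n) : Relation.EqvGen Move (E * D * F) (E * D' * F) := by
  induction h with
  | rel _ _ h => exact .rel _ _ (h.mul E F)
  | refl _ => exact .refl _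
  | symm _ _ _ ih => exact .symm _ _ ih
  | trans _ _ _ _ _ ih ih' => exact .trans _ _ _ ih ih'

/-- Equivalence of diagrams: the equivalence relation generated by the moves. It is compatible with
the composition of diagrams. -/
def equivalence (n : ℕ) : Con (Diagram n) where
  r := Relation.EqvGen Move
  iseqv := Relation.EqvGen.is_equivalence _
  mul' {a b c d} hab hcd := by
    have h₁ := eqvGen_mul 1 hab c
    have h₂ := eqvGen_mul b hcd 1
    simp only [one_mul, mul_one] at h₁ h₂
    exact h₁.trans _ _ _ h₂

/-- The monoid of virtual `n`-string links. -/
abbrev VirtualStringLink (n : ℕ) : Type := (equivalence n).Quotient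

/-- The virtual string link represented by a diagram. -/
def VirtualStringLink.mk {n : ℕ} (D : Diagram n) : VirtualStringLink n := (D : (equivalence n).Quotient)

/-! ### The bowling ball model -/

/-- The parameters of the bowling ball model. -/
structure BallModel (R : Type*) where
  t : R
  u : R
  v : R
  w : R
  s : R
  r : R

/-- The weight with which a ball changes lanes at a crossing of kind `c`, whose strands `\` and `/`
have the directions `x` and `y`, when it comes along `\` (`first = true`) or along `/`
(`first = false`).

A virtual crossing is viewed turned such that both strands go down. Then `\` comes from the left
exactly if `x = y`. A real crossing is positive exactly if `/` is the upper strand and `x = y`,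
or `\` is the upper strand and `x ≠ y`. -/
def BallModel.jump {R : Type*} [CommRing R] (W : BallModel R) (c : Crossing) (x y : Dir)
    (first : Bool) : R :=
  match c with
  | .virtual => if first = decide (x = y) then W.s else W.r
  | .real firstOver =>
    let positive := firstOver != decide (x = y)
    let upper := first == firstOver
    match positive, upper with
    | false, true => 1 - W.t
    | false, false => 1 - W.u
    | true, false => 1 - W.w
    | true, true => 1 - W.v

/-- The possible moves of a ball in an elementary tangle with `a` strands to the left of it:
(start, end, weight). -/
def Elem.ballMoves {R : Type*} [CommRing R] (W : BallModel R) (a : ℕ) :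
    Elem → List (Port × Port × R)
  | .cross c x y =>
    [ ((firstStrand a x).1, (firstStrand a x).2, 1 - W.jump c x y true),
      ((firstStrand a x).1, (secondStrand a y).2, W.jump c x y true),
      ((secondStrand a y).1, (secondStrand a y).2, 1 - W.jump c x y false),
      ((secondStrand a y).1, (firstStrand a x).2, W.jump c x y false) ]
  | .cup x => (Elem.arcs a (.cup x)).map (fun e => (e.1, e.2, 1))
  | .cap x => (Elem.arcs a (.cap x)).map (fun e => (e.1, e.2, 1))

/-- The possible moves of a ball in a slice. -/
def Slice.ballMoves {R : Type*} [CommRing R] (W : BallModel R) (σ : Slice) :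
    List (Port × Port × R) :=
  σ.sideArcs.map (fun e => (e.1, e.2, 1)) ++ σ.elem.ballMoves W σ.left.length

/-- In the diagram `w` a ball can get from `p` to `q` through one slice, with weight `x`. -/
def BallStep {R : Type*} [CommRing R] (W : BallModel R) (w : List Slice) (p q : Point) (x : R) :
    Prop :=
  ∃ (t : ℕ) (σ : Slice), w[t]? = some σ ∧ ∃ m ∈ σ.ballMoves W,
    p = m.1.place t ∧ q = m.2.1.place t ∧ x = m.2.2

/-- The ways in which a ball can walk from `p` to `q` along the diagram `w`. -/
inductive Path {R : Type*} [CommRing R] (W : BallModel R) (w : List Slice) : Point → Point → Type _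
  | nil (p : Point) : Path W w p p
  | cons {p q q' : Point} (x : R) (h : BallStep W w p q x) (γ : Path W w q q') : Path W w p q'

/-- The weight of a path: the product of the weights of its steps. -/
def Path.weight {R : Type*} [CommRing R] {W : BallModel R} {w : List Slice} {p q : Point} :
    Path W w p q → R
  | .nil _ => 1
  | .cons x _ γ => x * γ.weight

/-- The paths from the top of the `i`-th lane to the bottom of the `j`-th lane. -/
abbrev Diagram.LanePath {R : Type*} [CommRing R] (W : BallModel R) {n : ℕ} (D : Diagram n)
    (i j : Fin n) : Type _ :=
  Path W D.word (0, (i : ℕ)) (D.word.length, (j : ℕ))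

/-- The matrix whose `(i, j)` entry is the sum of the weights of all paths that begin in the `i`-th
lane and end in the `j`-th lane. -/
noncomputable def Diagram.ballMatrix {R : Type*} [CommRing R] (W : BallModel R) {n : ℕ}
    (D : Diagram n) : Matrix (Fin n) (Fin n) R :=
  Matrix.of fun i j => ∑ᶠ γ : D.LanePath W i j, γ.weight

/-- The ring `ℤ[s]/(s²)`. -/
abbrev Zs : Type := AdjoinRoot ((X : ℤ[X]) ^ 2)

/-- The class of `s` in `ℤ[s]/(s²)`. -/
noncomputable abbrev sVar : Zs := AdjoinRoot.root ((X : ℤ[X]) ^ 2)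

/-- The bowling ball model with `u = w = t = v = 1` and `r = -s` over `ℤ[s]/(s²)`. -/
noncomputable def model : BallModel Zs where
  t := 1
  u := 1
  v := 1
  w := 1
  s := sVar
  r := -sVar

/-- The matrix `M(L)` of a virtual string link diagram. -/
noncomputable abbrev Diagram.M {n : ℕ} (D : Diagram n) : Matrix (Fin n) (Fin n) Zs :=
  D.ballMatrix model

end VStringLink

/-!
Label the points of a diagram by ring elements such that the label of a point is the weighted mean
of the labels of the points that a ball reaches from there in one step. Walk sums to a fixed end
point form such a harmonic labelling. With `s² = 0`, and with jumps of weight `± s` at virtual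
crossings only, harmonic labels of a diagram are determined by the labels at the bottom
(`HarmonicOn.eq_zero`, by induction along the strings, which contain every point and end at the
bottom). So the pairs of top and bottom labels that extend over a diagram form the graph of its
matrix (`Diagram.wordRel_iff`).

Extendability is a local condition: the relation between top and bottom labels of a word is the
composite of the relations of its slices (`WordRel`). This makes the matrix multiplicative, and it
reduces invariance to an identity for each move (`LocalMove.wordRel`). There the mean value
property at a crossing turns out to be a rule for the lower labels in terms of the upper ones, in
which the directions of the strands enter as signs (`Elem.harmonic_cross_iff`), and in which the
products of the corrections from two crossings vanish. Maxima and minima only equate labels.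

A walk of non-zero weight jumps at most once at a virtual crossing, and otherwise follows strings,
which have no cycles (`Diagram.acyclic`). This gives finiteness (`Diagram.finite_weight_ne_zero`);
the part of a walk sum without `s` comes from the string itself, and is `0` or `1`.
-/

namespace VStringLink

variable {R : Type*} [CommRing R]

/-! ### Labelling relations -/

/-- The sign of a direction: `1` for `down` and `-1` for `up`. -/
def Dir.sign : Dir → R
  | .down => 1
  | .up => -1

@[simp] theorem Dir.sign_rev (x : Dir) : (x.rev.sign : R) = -x.sign := by
  cases x <;> simp [Dir.rev, Dir.sign]

/-- The coefficient by which a crossing mixes labels: `s` for a virtual crossing and `0` for a real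
one, at which a ball never jumps. -/
def Crossing.coeff (s : R) : Crossing → R
  | .real _ => 0
  | .virtual => s

@[simp] theorem Crossing.coeff_swap (s : R) (c : Crossing) : c.swap.coeff s = c.coeff s := by
  cases c <;> rfl

/-- All second order terms in the labelling rule vanish, for any two crossings. This single fact is
behind the bigon, kink and triangle moves, whatever the kinds of their crossings. -/
theorem Crossing.coeff_mul_coeff {s : R} (hs : s * s = 0) (c c' : Crossing) :
    c.coeff s * c'.coeff s = 0 := by
  cases c <;> cases c' <;> simp [Crossing.coeff, hs]

/-- The list `f` of labels at the top and the list `g` of labels at the bottom of an elementary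
tangle fit together. Labels `p`, `q` above a crossing determine those below; in this form, read from
top to bottom instead of along the strands, the directions enter through signs only. -/
def Elem.Rel (s : R) : Elem → List R → List R → Prop
  | .cross c x y, f, g => ∃ p q, f = [p, q] ∧
      g = [q - x.sign * c.coeff s * (q - p), p - y.sign * c.coeff s * (q - p)]
  | .cup _, f, g => ∃ p, f = [p, p] ∧ g = []
  | .cap _, f, g => ∃ p, f = [] ∧ g = [p, p]

/-- The labels `f` at the top and `g` at the bottom of a slice fit together: vertical strands keep
their label. -/
def Slice.Rel (s : R) (σ : Slice) (f g : List R) : Prop :=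
  ∃ u v m m', u.length = σ.left.length ∧ v.length = σ.right.length ∧
    f = u ++ m ++ v ∧ g = u ++ m' ++ v ∧ σ.elem.Rel s m m'

/-- The labels `f` at the top and `g` at the bottom extend to all intermediate levels of `w`. -/
def WordRel (s : R) : List Slice → List R → List R → Prop
  | [], f, g => f = g
  | σ :: w, f, g => ∃ h, σ.Rel s f h ∧ WordRel s w h g

theorem Elem.Rel.length {s : R} {e : Elem} {f g : List R} (h : e.Rel s f g) :
    f.length = e.dom.length ∧ g.length = e.cod.length := by
  cases e <;> simp only [Elem.Rel] at h <;> obtain ⟨p, h⟩ := h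
  · obtain ⟨q, rfl, rfl⟩ := h; exact ⟨rfl, rfl⟩
  · obtain ⟨rfl, rfl⟩ := h; exact ⟨rfl, rfl⟩
  · obtain ⟨rfl, rfl⟩ := h; exact ⟨rfl, rfl⟩

theorem WordRel.append_iff {s : R} {w w' : List Slice} {f g : List R} :
    WordRel s (w ++ w') f g ↔ ∃ h, WordRel s w f h ∧ WordRel s w' h g := by
  induction w generalizing f with
  | nil => simp [WordRel]
  | cons σ w ih =>
    simp only [List.cons_append, WordRel, ih]
    constructor
    · rintro ⟨h, h₁, k, h₂, h₃⟩; exact ⟨k, ⟨h, h₁, h₂⟩, h₃⟩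
    · rintro ⟨k, ⟨h, h₁, h₂⟩, h₃⟩; exact ⟨h, h₁, k, h₂, h₃⟩

theorem Slice.rel_pad_iff {s : R} {σ : Slice} {a b : List Dir} {F G : List R} :
    (σ.pad a b).Rel s F G ↔ ∃ u v f g, u.length = a.length ∧ v.length = b.length ∧
      F = u ++ f ++ v ∧ G = u ++ g ++ v ∧ σ.Rel s f g := by
  constructor
  · rintro ⟨u, v, m, m', hu, hv, rfl, rfl, h⟩
    simp only [Slice.pad, List.length_append] at hu hv
    refine ⟨u.take a.length, v.drop σ.right.length,
      u.drop a.length ++ m ++ v.take σ.right.length,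
      u.drop a.length ++ m' ++ v.take σ.right.length, by simp; omega, by simp; omega, ?_, ?_,
      u.drop a.length, v.take σ.right.length, m, m', by simp; omega, by simp; omega, rfl, rfl, h⟩
    · conv_lhs => rw [← List.take_append_drop a.length u, ← List.take_append_drop σ.right.length v]
      simp only [List.append_assoc]
    · conv_lhs => rw [← List.take_append_drop a.length u, ← List.take_append_drop σ.right.length v]
      simp only [List.append_assoc]
  · rintro ⟨u, v, f, g, hu, hv, rfl, rfl, u', v', m, m', hu', hv', rfl, rfl, h⟩
    exact ⟨u ++ u', v' ++ v, m, m', by simp [Slice.pad, hu, hu'], by simp [Slice.pad, hv, hv'],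
      by simp, by simp, h⟩

theorem WordRel.pad {s : R} {l : List Slice} {a b : List Dir} {u v f g : List R}
    (hu : u.length = a.length) (hv : v.length = b.length) (h : WordRel s l f g) :
    WordRel s (l.map (Slice.pad a b)) (u ++ f ++ v) (u ++ g ++ v) := by
  induction l generalizing f with
  | nil => cases h; rfl
  | cons σ l ih =>
    obtain ⟨k, hk, h⟩ := h
    exact ⟨u ++ k ++ v, Slice.rel_pad_iff.2 ⟨u, v, f, k, hu, hv, rfl, rfl, hk⟩, ih h⟩

theorem WordRel.of_pad_append {s : R} {l : List Slice} {a b : List Dir} {u v f G : List R}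
    (hu : u.length = a.length) (hv : v.length = b.length)
    (h : WordRel s (l.map (Slice.pad a b)) (u ++ f ++ v) G) :
    ∃ g, G = u ++ g ++ v ∧ WordRel s l f g := by
  induction l generalizing f with
  | nil => cases h; exact ⟨f, rfl, rfl⟩
  | cons σ l ih =>
    obtain ⟨k, hk, h⟩ := h
    obtain ⟨u', v', f', g', hu', hv', e, rfl, hr⟩ := Slice.rel_pad_iff.1 hk
    obtain ⟨e', rfl⟩ := List.append_inj' e (hv.trans hv'.symm)
    obtain ⟨rfl, rfl⟩ := List.append_inj e' (hu.trans hu'.symm)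
    obtain ⟨g, rfl, hg⟩ := ih h
    exact ⟨g, rfl, g', hr, hg⟩

/-- The part of a padded tangle inside the disc. For the empty tangle `F` might be too short to be
cut into three parts, hence `hl`. -/
theorem WordRel.of_pad {s : R} {l : List Slice} {a b : List Dir} {F G : List R} (hl : l ≠ [])
    (h : WordRel s (l.map (Slice.pad a b)) F G) :
    ∃ u v f g, u.length = a.length ∧ v.length = b.length ∧
      F = u ++ f ++ v ∧ G = u ++ g ++ v ∧ WordRel s l f g := by
  obtain ⟨σ, l, rfl⟩ := List.exists_cons_of_ne_nil hl
  obtain ⟨k, hk, h'⟩ := id h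
  obtain ⟨u, v, f, -, hu, hv, rfl, -, -⟩ := Slice.rel_pad_iff.1 hk
  obtain ⟨g, rfl, hg⟩ := WordRel.of_pad_append hu hv h
  exact ⟨u, v, f, g, hu, hv, rfl, rfl, hg⟩

/-! ### Invariance of the labelling relations under the moves -/

theorem LocalMove.ne_nil {l l' : List Slice} (h : LocalMove l l') : l ≠ [] := by
  cases h <;> simp

/-- Labels on the boundary that extend over the left-hand side of a move also extend over its
right-hand side. This one direction suffices, as both sides occur in diagrams whose bottom labels
determine the top labels. -/
theorem LocalMove.wordRel {s : R} (hs : s * s = 0) {l l' : List Slice} (h : LocalMove l l')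
    {f g : List R} (hl : WordRel s l f g) : WordRel s l' f g := by
  cases h with
  | commute e₁ e₂ m =>
    obtain ⟨k, ⟨u, v, p, p', hu, hv, rfl, rfl, h₁⟩, k', ⟨u', v', q, q', hu', hv', e, rfl, h₂⟩,
      rfl⟩ := hl
    simp only [List.length_nil, List.length_eq_zero_iff] at hu hv'
    subst hu hv'
    simp only [List.nil_append, List.append_nil] at e
    simp only [List.length_append] at hv hu'
    obtain ⟨n, v, rfl, hn, hv⟩ : ∃ n v', v = n ++ v' ∧ n.length = m.length ∧
        v'.length = e₂.dom.length :=
      ⟨v.take m.length, v.drop m.length, (List.take_append_drop _ _).symm, by simp; omega,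
        by simp; omega⟩
    rw [← List.append_assoc] at e
    obtain ⟨rfl, rfl⟩ := List.append_inj' e (hv.trans h₂.length.1.symm)
    exact ⟨p ++ n ++ q', ⟨p ++ n, [], v, q', by simp [h₁.length, hn], rfl, by simp, by simp, h₂⟩,
      p' ++ n ++ q', ⟨[], n ++ q', p, p', rfl, by simp [h₂.length, hn], by simp, by simp, h₁⟩,
      by simp [WordRel]⟩
  | zigzag_right x =>
    simp [WordRel, Slice.Rel, Elem.Rel, List.length_eq_one_iff] at hl ⊢
    obtain ⟨a, rfl, rfl⟩ := hl; rfl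
  | zigzag_left x =>
    simp [WordRel, Slice.Rel, Elem.Rel, List.length_eq_one_iff] at hl ⊢
    obtain ⟨a, rfl, ⟨b, rfl⟩, p, q, h⟩ := hl
    grind
  | slide_cap c x z =>
    have hc := Crossing.coeff_mul_coeff hs c c
    simp [WordRel, Slice.Rel, Elem.Rel, List.length_eq_one_iff] at hl ⊢
    obtain ⟨a, rfl, p, rfl⟩ := hl
    -- the label of the maximum after the strand `z` has slid over it
    refine ⟨a, rfl, p - z.sign * c.coeff s * (a - p), ?_⟩
    simp only [List.cons.injEq, and_true]
    refine ⟨?_, ?_⟩ <;> grind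
  | slide_cup c x z =>
    have hc := Crossing.coeff_mul_coeff hs c c
    simp [WordRel, Slice.Rel, Elem.Rel, List.length_eq_one_iff] at hl ⊢
    obtain ⟨p, q, rfl, rfl⟩ := hl
    refine ⟨q, _, p, rfl, ⟨_, rfl⟩, q, ?_⟩
    simp only [List.cons_append, List.nil_append, List.cons.injEq, and_true]
    refine ⟨?_, ?_⟩ <;> grind
  | kink_right c x =>
    have hc := Crossing.coeff_mul_coeff hs c c
    simp [WordRel, Slice.Rel, Elem.Rel, List.length_eq_one_iff] at hl ⊢
    obtain ⟨a, rfl, ⟨b, rfl⟩, p, q, h⟩ := hl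
    simp only [List.cons_append, List.nil_append, List.cons.injEq, and_true] at h ⊢
    -- the minimum gives `(p - a) * (1 + k) = 0` with `k * k = 0`, hence `p = a`
    grind
  | kink_left c x =>
    have hc := Crossing.coeff_mul_coeff hs c c
    simp [WordRel, Slice.Rel, Elem.Rel, List.length_eq_one_iff] at hl ⊢
    obtain ⟨a, rfl, p, h, rfl⟩ := hl
    simp only [List.cons.injEq, and_true]
    grind
  | bigon c x y =>
    have hc := Crossing.coeff_mul_coeff hs c c
    simp [WordRel, Slice.Rel, Elem.Rel] at hl ⊢
    obtain ⟨a, b, rfl, rfl⟩ := hl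
    simp only [List.cons.injEq, and_true]
    refine ⟨?_, ?_⟩ <;> grind
  | triangle c₁ c₂ c₃ h x y z =>
    have h₁₂ := Crossing.coeff_mul_coeff hs c₁ c₂
    have h₁₃ := Crossing.coeff_mul_coeff hs c₁ c₃
    have h₂₃ := Crossing.coeff_mul_coeff hs c₂ c₃
    simp [WordRel, Slice.Rel, Elem.Rel, List.length_eq_one_iff] at hl ⊢
    obtain ⟨r, p, q, rfl, rfl⟩ := hl
    refine ⟨p, q, r, rfl, ?_⟩
    generalize Crossing.coeff s c₁ = k₁, Crossing.coeff s c₂ = k₂, Crossing.coeff s c₃ = k₃,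
      (x.sign : R) = x, (y.sign : R) = y, (z.sign : R) = z at *
    simp only [List.cons.injEq, and_true]
    refine ⟨?_, ?_, ?_⟩ <;> grind

/-! ### Arcs of a slice -/

/-- The arc of the slice at this port starts there. -/
def Slice.IsStart (σ : Slice) : Port → Prop
  | .top k => σ.dom[k]? = some .down
  | .bot k => σ.cod[k]? = some .up

/-- The arc of the slice at this port ends there. -/
def Slice.IsEnd (σ : Slice) : Port → Prop
  | .top k => σ.dom[k]? = some .up
  | .bot k => σ.cod[k]? = some .down

/-- The other end of the strand at a given port, in a slice with `a` strands to the left of the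
elementary tangle. The ports are not checked to exist; on ports of the slice it is an involution. -/
def Elem.mate (a : ℕ) : Elem → Port → Port
  | .cross _ _ _, .top k => .bot (Equiv.swap a (a + 1) k)
  | .cross _ _ _, .bot k => .top (Equiv.swap a (a + 1) k)
  | .cup _, .top k =>
    if k < a then .bot k else if k = a then .top (a + 1) else if k = a + 1 then .top a
      else .bot (k - 2)
  | .cup _, .bot k => if k < a then .top k else .top (k + 2)
  | .cap _, .bot k =>
    if k < a then .top k else if k = a then .bot (a + 1) else if k = a + 1 then .bot a
      else .top (k - 2)
  | .cap _, .top k => if k < a then .bot k else .bot (k + 2)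

theorem Slice.mem_sideArcs {σ : Slice} {e : Port × Port} :
    e ∈ σ.sideArcs ↔
      (∃ (k : ℕ) (d : Dir), σ.left[k]? = some d ∧ e = d.arc (.top k) (.bot k)) ∨
      (∃ (k : ℕ) (d : Dir), σ.right[k]? = some d ∧
        e = d.arc (.top (σ.left.length + σ.elem.dom.length + k))
          (.bot (σ.left.length + σ.elem.cod.length + k))) := by
  simp only [sideArcs, List.mem_append, List.mem_mapIdx, List.getElem?_eq_some_iff]
  refine or_congr ?_ ?_
  all_goals
    constructor
    · rintro ⟨k, hk, rfl⟩; exact ⟨k, _, ⟨hk, rfl⟩, rfl⟩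
    · rintro ⟨k, d, ⟨hk, rfl⟩, rfl⟩; exact ⟨k, hk, rfl⟩

theorem Slice.isStart_isEnd_of_mem_arcs {σ : Slice} {e : Port × Port} (h : e ∈ σ.arcs) :
    σ.IsStart e.1 ∧ σ.IsEnd e.2 := by
  obtain ⟨u, E, v⟩ := σ
  rcases List.mem_append.1 h with h | h
  · rcases Slice.mem_sideArcs.1 h with ⟨k, d, hk, rfl⟩ | ⟨k, d, hk, rfl⟩
    · have := (List.getElem?_eq_some_iff.1 hk).1
      cases d <;>
        simp_all [Dir.arc, IsStart, IsEnd, dom, cod, List.getElem?_append_left]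
    · cases d <;>
        simp_all [Dir.arc, IsStart, IsEnd, dom, cod, List.getElem?_append, Nat.add_assoc]
  · cases E with
    | cross c x y =>
      simp only [Elem.arcs, List.mem_cons, List.not_mem_nil, or_false] at h
      rcases h with rfl | rfl
      · cases x <;> simp [firstStrand, Dir.arc, IsStart, IsEnd, dom, cod, Elem.dom, Elem.cod]
      · cases y <;> simp [secondStrand, Dir.arc, IsStart, IsEnd, dom, cod, Elem.dom, Elem.cod]
    | cup x =>
      simp only [Elem.arcs, List.mem_cons, List.not_mem_nil, or_false] at h
      subst h
      cases x <;> simp [Dir.arc, Dir.rev, IsStart, IsEnd, dom, Elem.dom]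
    | cap x =>
      simp only [Elem.arcs, List.mem_cons, List.not_mem_nil, or_false] at h
      subst h
      cases x <;> simp [Dir.arc, Dir.rev, IsStart, IsEnd, cod, Elem.cod]

theorem Slice.mate_of_mem_arcs {σ : Slice} {e : Port × Port} (h : e ∈ σ.arcs) :
    σ.elem.mate σ.left.length e.1 = e.2 ∧ σ.elem.mate σ.left.length e.2 = e.1 := by
  obtain ⟨u, E, v⟩ := σ
  rcases List.mem_append.1 h with h | h
  · rcases Slice.mem_sideArcs.1 h with ⟨k, d, hk, rfl⟩ | ⟨k, d, hk, rfl⟩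
    · have := (List.getElem?_eq_some_iff.1 hk).1
      dsimp only at this
      cases E <;> cases d <;> simp [Elem.mate, Dir.arc, Equiv.swap_apply_def] <;> grind
    · cases E <;> cases d <;> simp [Elem.mate, Dir.arc, Equiv.swap_apply_def, Elem.dom,
        Elem.cod] <;> grind
  · cases E with
    | cross c x y =>
      simp only [Elem.arcs, List.mem_cons, List.not_mem_nil, or_false] at h
      rcases h with rfl | rfl
      · cases x <;> simp [Elem.mate, firstStrand, Dir.arc]
      · cases y <;> simp [Elem.mate, secondStrand, Dir.arc]
    | cup x =>
      simp only [Elem.arcs, List.mem_cons, List.not_mem_nil, or_false] at h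
      subst h
      cases x <;> simp [Elem.mate, Dir.arc]
    | cap x =>
      simp only [Elem.arcs, List.mem_cons, List.not_mem_nil, or_false] at h
      subst h
      cases x <;> simp [Elem.mate, Dir.arc]

theorem Slice.mem_dom_cases {σ : Slice} {k : ℕ} {d : Dir} (h : σ.dom[k]? = some d) :
    σ.left[k]? = some d ∨
    (∃ j, k = σ.left.length + j ∧ σ.elem.dom[j]? = some d) ∨
    (∃ j, k = σ.left.length + σ.elem.dom.length + j ∧ σ.right[j]? = some d) := by
  simp only [dom, List.getElem?_append, List.length_append] at h
  split_ifs at h with h₁ h₂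
  · exact .inl h
  · exact .inr (.inl ⟨_, by omega, h⟩)
  · exact .inr (.inr ⟨_, by omega, h⟩)

theorem Slice.mem_cod_cases {σ : Slice} {k : ℕ} {d : Dir} (h : σ.cod[k]? = some d) :
    σ.left[k]? = some d ∨
    (∃ j, k = σ.left.length + j ∧ σ.elem.cod[j]? = some d) ∨
    (∃ j, k = σ.left.length + σ.elem.cod.length + j ∧ σ.right[j]? = some d) := by
  simp only [cod, List.getElem?_append, List.length_append] at h
  split_ifs at h with h₁ h₂
  · exact .inl h
  · exact .inr (.inl ⟨_, by omega, h⟩)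
  · exact .inr (.inr ⟨_, by omega, h⟩)

theorem Slice.exists_arc_of_isStart {σ : Slice} {P : Port} (h : σ.IsStart P) :
    ∃ Q, (P, Q) ∈ σ.arcs := by
  cases P with
  | top k =>
    rcases Slice.mem_dom_cases h with h | ⟨j, rfl, h⟩ | ⟨j, rfl, h'⟩
    · exact ⟨_, List.mem_append_left _ (Slice.mem_sideArcs.2 (.inl ⟨k, _, h, rfl⟩))⟩
    · suffices ∃ Q, (Port.top (σ.left.length + j), Q) ∈ σ.elem.arcs σ.left.length from
        this.imp fun Q hQ => List.mem_append_right _ hQ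
      generalize σ.left.length = a, σ.elem = E at *
      rcases E with ⟨c, x, y⟩ | x | x <;> rcases j with _ | _ | j <;> cases x <;> try cases y
      all_goals simp_all [Elem.dom, Elem.arcs, firstStrand, secondStrand, Dir.arc, Dir.rev]
    · exact ⟨_, List.mem_append_left _ (Slice.mem_sideArcs.2 (.inr ⟨j, _, h', rfl⟩))⟩
  | bot k =>
    rcases Slice.mem_cod_cases h with h | ⟨j, rfl, h⟩ | ⟨j, rfl, h'⟩
    · exact ⟨_, List.mem_append_left _ (Slice.mem_sideArcs.2 (.inl ⟨k, _, h, rfl⟩))⟩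
    · suffices ∃ Q, (Port.bot (σ.left.length + j), Q) ∈ σ.elem.arcs σ.left.length from
        this.imp fun Q hQ => List.mem_append_right _ hQ
      generalize σ.left.length = a, σ.elem = E at *
      rcases E with ⟨c, x, y⟩ | x | x <;> rcases j with _ | _ | j <;> cases x <;> try cases y
      all_goals simp_all [Elem.cod, Elem.arcs, firstStrand, secondStrand, Dir.arc, Dir.rev]
    · exact ⟨_, List.mem_append_left _ (Slice.mem_sideArcs.2 (.inr ⟨j, _, h', rfl⟩))⟩

/-! ### Points of a diagram and straight steps -/

/-- The direction at a level in which a strand enters a slice through the port. -/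
def Port.out : Port → Dir
  | .top _ => .down
  | .bot _ => .up

theorem Port.place_inj {t t' : ℕ} {P P' : Port} (h : P.place t = P'.place t')
    (ho : P.out = P'.out) : t = t' ∧ P = P' := by
  cases P <;> cases P' <;> simp_all [Port.place, Port.out]

/-- The direction of the diagram at a point, if the point exists. -/
def dirAt (o : List Dir) (w : List Slice) (p : Point) : Option Dir :=
  ((o :: w.map Slice.cod)[p.1]?).bind (·[p.2]?)

theorem isPoint_iff {o : List Dir} {w : List Slice} {p : Point} :
    IsPoint o w p ↔ ∃ d, dirAt o w p = some d := by
  simp only [IsPoint, dirAt, Option.bind_eq_some_iff]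
  constructor
  · rintro ⟨l, hl, h⟩; exact ⟨_, l, hl, List.getElem?_eq_getElem h⟩
  · rintro ⟨d, l, hl, h⟩; exact ⟨l, hl, (List.getElem?_eq_some_iff.1 h).1⟩

theorem IsTangle.level {o o' : List Dir} {w : List Slice} (h : IsTangle o w o') {t : ℕ} {σ : Slice}
    (ht : w[t]? = some σ) :
    (o :: w.map Slice.cod)[t]? = some σ.dom ∧ (o :: w.map Slice.cod)[t + 1]? = some σ.cod := by
  refine ⟨?_, by simp [ht]⟩
  induction w generalizing o t with
  | nil => simp at ht
  | cons τ w ih =>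
    cases t with
    | zero =>
      simp only [List.getElem?_cons_zero, Option.some.injEq] at ht
      subst ht; simpa using h.1
    | succ t => simpa using ih h.2 (by simpa using ht)

section Tangle

variable {o o' : List Dir} {w : List Slice} {t : ℕ} {σ : Slice} {P : Port}

theorem IsTangle.dirAt_start (h : IsTangle o w o') (ht : w[t]? = some σ) (hP : σ.IsStart P) :
    dirAt o w (P.place t) = some P.out := by
  cases P with
  | top k => simp [dirAt, Port.place, h.level ht, Port.out]; exact hP
  | bot k => simp only [dirAt, Port.place, h.level ht, Port.out]; exact hP

theorem IsTangle.dirAt_end (h : IsTangle o w o') (ht : w[t]? = some σ) (hP : σ.IsEnd P) :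
    dirAt o w (P.place t) = some P.out.rev := by
  cases P with
  | top k => simp [dirAt, Port.place, h.level ht, Port.out]; exact hP
  | bot k => simp only [dirAt, Port.place, h.level ht, Port.out]; exact hP

/-- The direction of travel at a point decides which of the two adjacent slices a strand enters. -/
theorem IsTangle.start_unique (h : IsTangle o w o') (ht : w[t]? = some σ) (hP : σ.IsStart P)
    {t' : ℕ} {σ' : Slice} {P' : Port} (ht' : w[t']? = some σ') (hP' : σ'.IsStart P')
    (e : P.place t = P'.place t') : t = t' ∧ σ = σ' ∧ P = P' := by
  have h₁ := h.dirAt_start ht hP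
  rw [e, h.dirAt_start ht' hP', Option.some.injEq] at h₁
  obtain ⟨rfl, rfl⟩ := Port.place_inj e h₁.symm
  exact ⟨rfl, Option.some.inj (ht.symm.trans ht'), rfl⟩

theorem IsTangle.end_unique (h : IsTangle o w o') (ht : w[t]? = some σ) (hP : σ.IsEnd P)
    {t' : ℕ} {σ' : Slice} {P' : Port} (ht' : w[t']? = some σ') (hP' : σ'.IsEnd P')
    (e : P.place t = P'.place t') : t = t' ∧ σ = σ' ∧ P = P' := by
  have h₁ := h.dirAt_end ht hP
  rw [e, h.dirAt_end ht' hP', Option.some.injEq] at h₁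
  have h₂ : P.out = P'.out := by
    revert h₁; cases P <;> cases P' <;> simp [Port.out, Dir.rev]
  obtain ⟨rfl, rfl⟩ := Port.place_inj e h₂
  exact ⟨rfl, Option.some.inj (ht.symm.trans ht'), rfl⟩

theorem IsTangle.straightStep_injective (h : IsTangle o w o') {p p' q : Point}
    (h₁ : StraightStep w p q) (h₂ : StraightStep w p' q) : p = p' := by
  obtain ⟨t, σ, ht, a, ha, rfl, rfl⟩ := h₁
  obtain ⟨t', σ', ht', a', ha', rfl, e⟩ := h₂
  obtain ⟨rfl, rfl, e⟩ := h.end_unique ht (Slice.isStart_isEnd_of_mem_arcs ha).2 ht'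
    (Slice.isStart_isEnd_of_mem_arcs ha').2 e
  rw [← (Slice.mate_of_mem_arcs ha).2, ← (Slice.mate_of_mem_arcs ha').2, e]

/-- Apart from the end points of the tangle, each point is where an arc of some slice starts. -/
theorem IsTangle.exists_start (h : IsTangle o w o') {p : Point} {d : Dir}
    (hp : dirAt o w p = some d) :
    (∃ (t : ℕ) (σ : Slice) (P : Port), w[t]? = some σ ∧ σ.IsStart P ∧ p = P.place t) ∨
      (p.1 = 0 ∧ o[p.2]? = some .up) ∨ (p.1 = w.length ∧ o'[p.2]? = some .down) := by
  obtain ⟨t, k⟩ := p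
  obtain ⟨l, hl, hk⟩ := Option.bind_eq_some_iff.1 hp
  have hlen : t < w.length + 1 := by simpa using (List.getElem?_eq_some_iff.1 hl).1
  cases d with
  | down =>
    by_cases ht : t = w.length
    · subst ht
      refine .inr (.inr ⟨rfl, ?_⟩)
      cases hl.symm.trans h.last; exact hk
    · have hσ : w[t]? = some w[t] := List.getElem?_eq_getElem (by omega)
      refine .inl ⟨t, _, .top k, hσ, ?_, rfl⟩
      cases hl.symm.trans (h.level hσ).1; exact hk
  | up =>
    cases t with
    | zero => cases hl; exact .inr (.inl ⟨rfl, hk⟩)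
    | succ t =>
      have hσ : w[t]? = some w[t] := List.getElem?_eq_getElem (by omega)
      refine .inl ⟨t, _, .bot k, hσ, ?_, rfl⟩
      cases hl.symm.trans (h.level hσ).2; exact hk

end Tangle

section Diagram

variable {n : ℕ} (D : Diagram n)

theorem Diagram.dirAt_top {i : ℕ} (hi : i < n) :
    dirAt (strings n) D.word (0, i) = some .down := by
  simp [dirAt, strings, hi]

theorem Diagram.dirAt_bot {i : ℕ} (hi : i < n) :
    dirAt (strings n) D.word (D.word.length, i) = some .down := by
  simp only [dirAt, D.isTangle.last]
  simp [strings, hi]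

theorem Diagram.exists_start {p : Point} (hp : IsPoint (strings n) D.word p) :
    (∃ (t : ℕ) (σ : Slice) (P : Port), D.word[t]? = some σ ∧ σ.IsStart P ∧ p = P.place t) ∨
      (∃ i < n, p = (D.word.length, i)) := by
  obtain ⟨d, hd⟩ := isPoint_iff.1 hp
  rcases D.isTangle.exists_start hd with h | ⟨-, h⟩ | ⟨h₁, h⟩
  · exact .inl h
  · simp [strings, List.getElem?_replicate] at h
  · refine .inr ⟨p.2, ?_, by rw [← h₁]⟩
    simpa [strings] using (List.getElem?_eq_some_iff.1 h).1

theorem Diagram.place_ne_bot {t : ℕ} {σ : Slice} {P : Port} (ht : D.word[t]? = some σ)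
    (hP : σ.IsStart P) {i : ℕ} (hi : i < n) : P.place t ≠ (D.word.length, i) := by
  intro e
  have h := D.isTangle.dirAt_start ht hP
  rw [e, D.dirAt_bot hi, Option.some.injEq] at h
  have := (List.getElem?_eq_some_iff.1 ht).1
  cases P with
  | top k => simp only [Port.place, Prod.mk.injEq] at e; omega
  | bot k => simp [Port.out] at h

theorem Diagram.not_straightStep_top {p : Point} {i : ℕ} (hi : i < n) :
    ¬ StraightStep D.word p (0, i) := by
  rintro ⟨t, σ, ht, a, ha, -, e⟩
  have h := D.isTangle.dirAt_end ht (Slice.isStart_isEnd_of_mem_arcs ha).2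
  rw [← e, D.dirAt_top hi, Option.some.injEq] at h
  revert e h
  cases a.2 <;> simp [Port.out, Port.place, Dir.rev]

/-- A cycle through a point of the string from `(0, i)` could be traced back along the string, as
straight steps are injective, to a cycle through `(0, i)`; but no arc ends there. -/
theorem Diagram.acyclic {p : Point} (hp : IsPoint (strings n) D.word p) :
    ¬ Relation.TransGen (StraightStep D.word) p p := by
  obtain ⟨i, hi, h⟩ := D.noClosed p hp
  clear hp
  induction h with
  | refl =>
    intro h
    obtain ⟨q, -, h⟩ := Relation.TransGen.tail'_iff.1 h
    exact D.not_straightStep_top hi h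
  | tail _ hq ih =>
    intro h
    obtain ⟨r, hr, h⟩ := Relation.TransGen.tail'_iff.1 h
    obtain rfl := D.isTangle.straightStep_injective hq h
    exact ih (Relation.TransGen.head' hq hr)

theorem finite_isPoint (o : List Dir) (w : List Slice) : {p | IsPoint o w p}.Finite := by
  have : {p | IsPoint o w p} ⊆
      ⋃ t ∈ Finset.range (w.length + 1), ⋃ l ∈ (o :: w.map Slice.cod),
        (fun k => (t, k)) '' Set.Iio l.length := by
    rintro ⟨t, k⟩ ⟨l, hl, hk⟩
    obtain ⟨h, rfl⟩ := List.getElem?_eq_some_iff.1 hl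
    simp only [Set.mem_iUnion, Set.mem_image, Set.mem_Iio]
    exact ⟨t, by simpa using h, _, List.getElem_mem h, k, hk, rfl⟩
  refine Set.Finite.subset ?_ this
  refine Set.Finite.biUnion (Finset.finite_toSet _) fun t _ => ?_
  exact Set.Finite.biUnion (List.finite_toSet _) fun l _ => (Set.finite_Iio _).image _

theorem Diagram.straightStep_isPoint {p q : Point} (h : StraightStep D.word p q) :
    IsPoint (strings n) D.word q := by
  obtain ⟨t, σ, ht, a, ha, rfl, rfl⟩ := h
  exact isPoint_iff.2 ⟨_, D.isTangle.dirAt_end ht (Slice.isStart_isEnd_of_mem_arcs ha).2⟩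

/-- Induction from the ends of the strings upwards, against their orientation. -/
theorem Diagram.straightStep_induction {C : Point → Prop}
    (ind : ∀ p, IsPoint (strings n) D.word p → (∀ q, StraightStep D.word p q → C q) → C p) :
    ∀ p, IsPoint (strings n) D.word p → C p := by
  let S := {p : Point // IsPoint (strings n) D.word p}
  have : Finite S := (finite_isPoint _ _).to_subtype
  let r : S → S → Prop := fun a b => Relation.TransGen (StraightStep D.word) b.1 a.1
  have : IsTrans S r := ⟨fun a b c hab hbc => hbc.trans hab⟩
  have : Std.Irrefl r := ⟨fun a => D.acyclic a.2⟩
  have hwf : WellFounded r := Finite.wellFounded_of_trans_of_irrefl r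
  intro p hp
  exact hwf.induction (C := fun a : S => C a.1) ⟨p, hp⟩ fun a ih =>
    ind a.1 a.2 fun q hq => ih ⟨q, D.straightStep_isPoint hq⟩ (.single hq)

end Diagram

/-! ### Steps of a ball -/

theorem Port.place_injective (t : ℕ) : Function.Injective (Port.place t) := by
  intro P P' h
  cases P <;> cases P' <;> simp_all [Port.place]

/-- Vertical strands and strands of the elementary tangle have no starting point in common. -/
theorem Slice.sideArc_fst_ne {σ : Slice} {e a : Port × Port} (he : e ∈ σ.sideArcs)
    (ha : a ∈ σ.elem.arcs σ.left.length) : e.1 ≠ a.1 := by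
  obtain ⟨u, E, v⟩ := σ
  rcases Slice.mem_sideArcs.1 he with ⟨k, d, hk, rfl⟩ | ⟨k, d, -, rfl⟩
  · have := (List.getElem?_eq_some_iff.1 hk).1
    dsimp only at this ha
    rcases E with ⟨c, x, y⟩ | x | x <;> cases d <;> cases x <;> try cases y
    all_goals
      simp only [Elem.arcs, List.mem_cons, List.not_mem_nil, or_false] at ha
      grind [firstStrand, secondStrand, Dir.arc]
  · dsimp only at ha
    rcases E with ⟨c, x, y⟩ | x | x <;> cases d <;> cases x <;> try cases y
    all_goals
      simp only [Elem.arcs, List.mem_cons, List.not_mem_nil, or_false] at ha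
      grind [firstStrand, secondStrand, Dir.arc, Elem.dom, Elem.cod]

theorem Elem.exists_arc_of_mem_ballMoves {W : BallModel R} {a : ℕ} {e : Elem} {m : Port × Port × R}
    (h : m ∈ e.ballMoves W a) : ∃ b ∈ e.arcs a, m.1 = b.1 := by
  cases e with
  | cross c x y =>
    simp only [Elem.ballMoves, List.mem_cons, List.not_mem_nil, or_false] at h
    simp only [Elem.arcs, List.mem_cons, List.not_mem_nil, or_false]
    rcases h with rfl | rfl | rfl | rfl
    exacts [⟨_, .inl rfl, rfl⟩, ⟨_, .inl rfl, rfl⟩, ⟨_, .inr rfl, rfl⟩, ⟨_, .inr rfl, rfl⟩]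
  | cup x =>
    obtain ⟨b, hb, rfl⟩ := List.mem_map.1 h
    exact ⟨b, hb, rfl⟩
  | cap x =>
    obtain ⟨b, hb, rfl⟩ := List.mem_map.1 h
    exact ⟨b, hb, rfl⟩

theorem Slice.isStart_of_mem_ballMoves {W : BallModel R} {σ : Slice} {m : Port × Port × R}
    (h : m ∈ σ.ballMoves W) : σ.IsStart m.1 := by
  rcases List.mem_append.1 h with h | h
  · obtain ⟨e, he, rfl⟩ := List.mem_map.1 h
    exact (Slice.isStart_isEnd_of_mem_arcs (List.mem_append_left _ he)).1
  · obtain ⟨b, hb, e⟩ := Elem.exists_arc_of_mem_ballMoves h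
    rw [e]
    exact (Slice.isStart_isEnd_of_mem_arcs (List.mem_append_right _ hb)).1

theorem Slice.mem_ballMoves_of_sideArc {W : BallModel R} {σ : Slice} {e : Port × Port}
    (he : e ∈ σ.sideArcs) {Q : Port} {x : R} :
    (e.1, Q, x) ∈ σ.ballMoves W ↔ Q = e.2 ∧ x = 1 := by
  constructor
  · intro h
    rcases List.mem_append.1 h with h | h
    · obtain ⟨e', he', h⟩ := List.mem_map.1 h
      simp only [Prod.mk.injEq] at h
      refine ⟨?_, h.2.2.symm⟩
      rw [← h.2.1, ← (Slice.mate_of_mem_arcs (List.mem_append_left _ he)).1,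
        ← (Slice.mate_of_mem_arcs (List.mem_append_left _ he')).1, h.1]
    · obtain ⟨b, hb, h⟩ := Elem.exists_arc_of_mem_ballMoves h
      exact absurd h (Slice.sideArc_fst_ne he hb)
  · rintro ⟨rfl, rfl⟩
    exact List.mem_append_left _ (List.mem_map.2 ⟨e, he, rfl⟩)

theorem Slice.mem_ballMoves_of_elemArc {W : BallModel R} {σ : Slice} {e : Port × Port}
    (he : e ∈ σ.elem.arcs σ.left.length) {Q : Port} {x : R} :
    (e.1, Q, x) ∈ σ.ballMoves W ↔ (e.1, Q, x) ∈ σ.elem.ballMoves W σ.left.length := by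
  simp only [ballMoves, List.mem_append, or_iff_right_iff_imp]
  intro h
  obtain ⟨e', he', h⟩ := List.mem_map.1 h
  simp only [Prod.mk.injEq] at h
  exact absurd h.1 (Slice.sideArc_fst_ne he' he)

theorem firstStrand_ne_secondStrand (a : ℕ) (x y : Dir) :
    (firstStrand a x).1 ≠ (secondStrand a y).1 ∧ (firstStrand a x).2 ≠ (secondStrand a y).2 := by
  cases x <;> cases y <;> simp [firstStrand, secondStrand, Dir.arc]

theorem IsTangle.ballStep_iff {o o' : List Dir} {w : List Slice} (h : IsTangle o w o')
    {W : BallModel R} {t : ℕ} {σ : Slice} {P : Port} (ht : w[t]? = some σ) (hP : σ.IsStart P)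
    {q : Point} {x : R} :
    BallStep W w (P.place t) q x ↔ ∃ Q, (P, Q, x) ∈ σ.ballMoves W ∧ q = Q.place t := by
  constructor
  · rintro ⟨t', σ', ht', ⟨P', Q, y⟩, hm, e, rfl, rfl⟩
    obtain ⟨rfl, rfl, rfl⟩ := h.start_unique ht hP ht' (Slice.isStart_of_mem_ballMoves hm) e
    exact ⟨Q, hm, rfl⟩
  · rintro ⟨Q, hm, rfl⟩
    exact ⟨t, σ, ht, _, hm, rfl, rfl, rfl⟩

theorem Diagram.not_ballStep_bot {n : ℕ} (D : Diagram n) {W : BallModel R} {i : ℕ} (hi : i < n)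
    {q : Point} {x : R} : ¬ BallStep W D.word (D.word.length, i) q x := by
  rintro ⟨t, σ, ht, m, hm, e, -⟩
  exact D.place_ne_bot ht (Slice.isStart_of_mem_ballMoves hm) hi e.symm

/-! ### Sums over walks -/

/-- The sum of the weights of all walks from `p` to `e`; the junk value `0` of an infinite sum is
excluded by `Diagram.finite_weight_ne_zero` where this matters. -/
noncomputable def pathSum (W : BallModel R) (w : List Slice) (p e : Point) : R :=
  ∑ᶠ γ : Path W w p e, γ.weight

section PathSum

variable {W : BallModel R} {w : List Slice} {p q r e : Point} {a b : R}

theorem Path.eq_nil (he : ∀ q x, ¬ BallStep W w e q x) (γ : Path W w e e) : γ = .nil e := by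
  cases γ with
  | nil => rfl
  | cons x h γ => exact absurd h (he _ _)

theorem pathSum_self (he : ∀ q x, ¬ BallStep W w e q x) : pathSum W w e e = 1 := by
  rw [pathSum, finsum_eq_single _ (Path.nil e) fun γ h => absurd (Path.eq_nil he γ) h]
  rfl

theorem pathSum_eq_zero (hp : ∀ q x, ¬ BallStep W w p q x) (hpe : p ≠ e) : pathSum W w p e = 0 := by
  rw [pathSum]
  have : IsEmpty (Path W w p e) := ⟨fun γ => by
    cases γ with
    | nil => exact hpe rfl
    | cons x h γ => exact hp _ _ h⟩
  exact finsum_of_isEmpty _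

theorem pathSum_of_unique (h : ∀ q' x, BallStep W w p q' x ↔ q' = q ∧ x = 1) (hpe : p ≠ e) :
    pathSum W w p e = pathSum W w q e := by
  have hq : BallStep W w p q 1 := (h _ _).2 ⟨rfl, rfl⟩
  symm
  refine finsum_eq_of_bijective (Path.cons 1 hq) ⟨fun γ γ' h => by simpa using h, fun γ => ?_⟩
    fun γ => (one_mul _).symm
  cases γ with
  | nil => exact absurd rfl hpe
  | cons x h' γ =>
    obtain ⟨rfl, rfl⟩ := (h _ _).1 h'
    exact ⟨γ, rfl⟩

theorem Path.finite_weight_ne_zero_of_two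
    (h : ∀ q' x, BallStep W w p q' x → (q' = q ∧ x = a) ∨ (q' = r ∧ x = b)) (hpe : p ≠ e) (c : R)
    (hq : {γ : Path W w q e | c * (a * γ.weight) ≠ 0}.Finite)
    (hr : {γ : Path W w r e | c * (b * γ.weight) ≠ 0}.Finite) :
    {γ : Path W w p e | c * γ.weight ≠ 0}.Finite := by
  have aux : ∀ q' x, {γ : Path W w q' e | c * (x * γ.weight) ≠ 0}.Finite →
      {γ : Path W w p e | c * γ.weight ≠ 0 ∧ ∃ h γ', γ = .cons (q := q') x h γ'}.Finite := by
    intro q' x hf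
    by_cases hx : BallStep W w p q' x
    · refine (hf.image (Path.cons x hx)).subset ?_
      rintro _ ⟨h₁, h₂, γ', rfl⟩
      exact ⟨γ', h₁, rfl⟩
    · convert Set.finite_empty
      ext γ
      simp only [Set.mem_ofPred_eq, Set.mem_empty_iff_false, iff_false]
      rintro ⟨-, h', -⟩
      exact hx h'
  refine ((aux q a hq).union (aux r b hr)).subset ?_
  intro γ hγ
  cases γ with
  | nil => exact absurd rfl hpe
  | cons x h' γ =>
    rcases h _ _ h' with ⟨rfl, rfl⟩ | ⟨rfl, rfl⟩
    · exact .inl ⟨hγ, h', γ, rfl⟩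
    · exact .inr ⟨hγ, h', γ, rfl⟩

theorem pathSum_of_two (h : ∀ q' x, BallStep W w p q' x ↔ (q' = q ∧ x = a) ∨ (q' = r ∧ x = b))
    (hqr : q ≠ r) (hpe : p ≠ e)
    (hq : {γ : Path W w q e | γ.weight ≠ 0}.Finite)
    (hr : {γ : Path W w r e | γ.weight ≠ 0}.Finite) :
    pathSum W w p e = a * pathSum W w q e + b * pathSum W w r e := by
  have h₁ : BallStep W w p q a := (h _ _).2 (.inl ⟨rfl, rfl⟩)
  have h₂ : BallStep W w p r b := (h _ _).2 (.inr ⟨rfl, rfl⟩)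
  rw [pathSum, pathSum, pathSum, mul_finsum' _ _ hq, mul_finsum' _ _ hr, ← finsum_mem_univ]
  have hu : Set.univ = Set.range (Path.cons (q' := e) a h₁) ∪ Set.range (Path.cons b h₂) := by
    symm
    rw [Set.eq_univ_iff_forall]
    intro γ
    cases γ with
    | nil => exact absurd rfl hpe
    | cons x h' γ =>
      rcases (h _ _).1 h' with ⟨rfl, rfl⟩ | ⟨rfl, rfl⟩
      · exact .inl ⟨γ, rfl⟩
      · exact .inr ⟨γ, rfl⟩
  have hfin : ∀ (q' : Point) (x : R) (h' : BallStep W w p q' x),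
      {γ : Path W w q' e | γ.weight ≠ 0}.Finite →
      (Set.range (Path.cons (q' := e) x h') ∩ Function.support Path.weight).Finite := by
    intro q' x h' hf
    refine (hf.image (Path.cons x h')).subset ?_
    rintro _ ⟨⟨γ, rfl⟩, hγ⟩
    exact ⟨γ, fun h0 => hγ (by simp [Path.weight, h0]), rfl⟩
  rw [hu, finsum_mem_union' _ (hfin _ _ _ hq) (hfin _ _ _ hr), finsum_mem_range,
    finsum_mem_range]
  · rfl
  · intro γ γ' h; simpa using h
  · intro γ γ' h; simpa using h
  · rw [Set.disjoint_left]
    rintro _ ⟨γ, rfl⟩ ⟨γ', h'⟩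
    simp only [Path.cons.injEq] at h'
    exact hqr h'.1.symm

end PathSum

/-! ### Harmonic labellings -/

/-- The bowling ball model in which balls jump at virtual crossings only: with weight `s` from the
left and `-s` from the right. -/
def twist (s : R) : BallModel R where
  t := 1
  u := 1
  v := 1
  w := 1
  s := s
  r := -s

theorem jump_twist (s : R) (c : Crossing) (x y : Dir) (b : Bool) :
    (twist s).jump c x y b = (if b then 1 else -1) * x.sign * y.sign * c.coeff s := by
  rcases c with (_ | _) | _ <;> cases x <;> cases y <;> cases b <;>
    simp [BallModel.jump, twist, Dir.sign, Crossing.coeff]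

theorem exists_jump_twist (s : R) (c : Crossing) (x y : Dir) (b : Bool) :
    ∃ ε : ℤ, (twist s).jump c x y b = ε * s := by
  rw [jump_twist]
  cases c with
  | real => exact ⟨0, by simp [Crossing.coeff]⟩
  | virtual =>
    cases x <;> cases y <;> cases b <;>
      first
      | refine ⟨1, ?_⟩; simp [Dir.sign, Crossing.coeff]; done
      | refine ⟨-1, ?_⟩; simp [Dir.sign, Crossing.coeff]

/-- The labelling `ℓ` of the ports satisfies the mean value property at the starting points of the
arcs of the elementary tangle, where balls move according to `W`. -/
def Elem.Harmonic (W : BallModel R) (a : ℕ) (ℓ : Port → R) : Elem → Prop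
  | .cross c x y =>
    ℓ (firstStrand a x).1 = (1 - W.jump c x y true) * ℓ (firstStrand a x).2 +
      W.jump c x y true * ℓ (secondStrand a y).2 ∧
    ℓ (secondStrand a y).1 = (1 - W.jump c x y false) * ℓ (secondStrand a y).2 +
      W.jump c x y false * ℓ (firstStrand a x).2
  | .cup x => ∀ e ∈ Elem.arcs a (.cup x), ℓ e.1 = ℓ e.2
  | .cap x => ∀ e ∈ Elem.arcs a (.cap x), ℓ e.1 = ℓ e.2

/-- The mean value property at all starting points of the arcs of a slice. -/
def Slice.Harmonic (W : BallModel R) (σ : Slice) (ℓ : Port → R) : Prop :=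
  (∀ e ∈ σ.sideArcs, ℓ e.1 = ℓ e.2) ∧ σ.elem.Harmonic W σ.left.length ℓ

/-- The labelling `L` of points is harmonic: its value at a point is the weighted mean of its values
at the points that a ball reaches from there in one step. -/
def HarmonicOn (W : BallModel R) (w : List Slice) (L : Point → R) : Prop :=
  ∀ (t : ℕ) (σ : Slice), w[t]? = some σ → σ.Harmonic W fun P => L (P.place t)

/-- At a crossing, all four directed forms of the mean value property amount to one rule that gives
the lower labels in terms of the upper ones. -/
theorem Elem.harmonic_cross_iff {s : R} (hs : s * s = 0) {a : ℕ} {ℓ : Port → R} {c : Crossing}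
    {x y : Dir} : (Elem.cross c x y).Harmonic (twist s) a ℓ ↔
      ℓ (.bot a) = ℓ (.top (a + 1)) - x.sign * c.coeff s * (ℓ (.top (a + 1)) - ℓ (.top a)) ∧
      ℓ (.bot (a + 1)) = ℓ (.top a) - y.sign * c.coeff s * (ℓ (.top (a + 1)) - ℓ (.top a)) := by
  have hc := Crossing.coeff_mul_coeff hs c c
  simp only [Elem.Harmonic, jump_twist]
  generalize c.coeff s = k at *
  cases x <;> cases y <;> simp only [firstStrand, secondStrand, Dir.arc, Dir.sign] <;>
    generalize ℓ (.bot a) = p', ℓ (.bot (a + 1)) = q', ℓ (.top a) = p, ℓ (.top (a + 1)) = q <;>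
    constructor <;> rintro ⟨h₁, h₂⟩ <;> constructor <;> grind

theorem Elem.harmonic_cup_iff {W : BallModel R} {a : ℕ} {ℓ : Port → R} {x : Dir} :
    (Elem.cup x).Harmonic W a ℓ ↔ ℓ (.top a) = ℓ (.top (a + 1)) := by
  cases x <;> simp [Elem.Harmonic, Elem.arcs, Dir.arc, eq_comm]

theorem Elem.harmonic_cap_iff {W : BallModel R} {a : ℕ} {ℓ : Port → R} {x : Dir} :
    (Elem.cap x).Harmonic W a ℓ ↔ ℓ (.bot a) = ℓ (.bot (a + 1)) := by
  cases x <;> simp [Elem.Harmonic, Elem.arcs, Dir.arc, eq_comm]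

omit [CommRing R] in
theorem Slice.sideArcs_harmonic_iff {σ : Slice} {ℓ : Port → R} :
    (∀ e ∈ σ.sideArcs, ℓ e.1 = ℓ e.2) ↔
      (∀ k < σ.left.length, ℓ (.top k) = ℓ (.bot k)) ∧
      (∀ k < σ.right.length, ℓ (.top (σ.left.length + σ.elem.dom.length + k)) =
        ℓ (.bot (σ.left.length + σ.elem.cod.length + k))) := by
  have key : ∀ (d : Dir) (P Q : Port), ℓ (d.arc P Q).1 = ℓ (d.arc P Q).2 ↔ ℓ P = ℓ Q := by
    intro d P Q; cases d <;> simp [Dir.arc, eq_comm]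
  constructor
  · intro h
    refine ⟨fun k hk => ?_, fun k hk => ?_⟩
    · exact (key σ.left[k] _ _).1 (h _ (Slice.mem_sideArcs.2
        (.inl ⟨k, _, List.getElem?_eq_getElem hk, rfl⟩)))
    · exact (key σ.right[k] _ _).1 (h _ (Slice.mem_sideArcs.2
        (.inr ⟨k, _, List.getElem?_eq_getElem hk, rfl⟩)))
  · rintro ⟨h₁, h₂⟩ e he
    rcases Slice.mem_sideArcs.1 he with ⟨k, d, hk, rfl⟩ | ⟨k, d, hk, rfl⟩
    · exact (key _ _ _).2 (h₁ k (List.getElem?_eq_some_iff.1 hk).1)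
    · exact (key _ _ _).2 (h₂ k (List.getElem?_eq_some_iff.1 hk).1)

theorem Slice.Harmonic.rel {s : R} (hs : s * s = 0) {σ : Slice} {ℓ : Port → R}
    (h : σ.Harmonic (twist s) ℓ) :
    σ.Rel s ((List.range σ.dom.length).map fun k => ℓ (.top k))
      ((List.range σ.cod.length).map fun k => ℓ (.bot k)) := by
  obtain ⟨u, E, v⟩ := σ
  obtain ⟨h₁, h₂⟩ := h
  obtain ⟨hl, hr⟩ := Slice.sideArcs_harmonic_iff.1 h₁
  dsimp only at hl hr h₂
  refine ⟨(List.range u.length).map fun k => ℓ (.top k),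
    (List.range v.length).map fun k => ℓ (.top (u.length + E.dom.length + k)),
    (List.range E.dom.length).map fun k => ℓ (.top (u.length + k)),
    (List.range E.cod.length).map fun k => ℓ (.bot (u.length + k)), by simp, by simp, ?_, ?_, ?_⟩
  · simp [Slice.dom, List.range_add, Function.comp_def, Nat.add_assoc]
  · simp only [Slice.cod, List.length_append, List.range_add, List.map_append, List.map_map,
      Function.comp_def, Nat.add_assoc]
    simp only [← Nat.add_assoc]
    rw [List.append_assoc]
    congr 1
    · exact List.map_congr_left fun k hk => (hl k (List.mem_range.1 hk)).symm
    · congr 1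
      exact List.map_congr_left fun k hk => (hr k (List.mem_range.1 hk)).symm
  · cases E with
    | cross c x y =>
      obtain ⟨h₃, h₄⟩ := (Elem.harmonic_cross_iff hs).1 h₂
      exact ⟨ℓ (.top u.length), ℓ (.top (u.length + 1)), rfl, by
        simp [Elem.cod, List.range_succ, h₃, h₄]⟩
    | cup x =>
      exact ⟨ℓ (.top u.length), by
        simp [Elem.dom, List.range_succ, (Elem.harmonic_cup_iff.1 h₂).symm], rfl⟩
    | cap x =>
      exact ⟨ℓ (.bot u.length), rfl, by
        simp [Elem.cod, List.range_succ, (Elem.harmonic_cap_iff.1 h₂).symm]⟩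

/-- The labelling of the ports of a slice by lists of labels at the top and at the bottom, with junk
value `0` outside the slice. -/
def portLabel (f g : List R) : Port → R
  | .top k => f.getD k 0
  | .bot k => g.getD k 0

theorem Slice.Rel.harmonic {s : R} (hs : s * s = 0) {σ : Slice} {f g : List R}
    (h : σ.Rel s f g) : σ.Harmonic (twist s) (portLabel f g) := by
  obtain ⟨u, E, v⟩ := σ
  obtain ⟨p, q, m, m', hp, hq, rfl, rfl, h⟩ := h
  have hlen := h.length
  dsimp only at hp hq h hlen
  refine ⟨Slice.sideArcs_harmonic_iff.2 ⟨fun k hk => ?_, fun k hk => ?_⟩, ?_⟩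
  · dsimp only at hk
    simp only [portLabel]
    grind
  · simp only [portLabel, ← hp, ← hlen.1, ← hlen.2]
    simp [List.getD_eq_getElem?_getD, List.getElem?_append, Nat.add_assoc]
  · cases E with
    | cross c x y =>
      obtain ⟨a, b, rfl, rfl⟩ := h
      rw [Elem.harmonic_cross_iff hs]
      simp [portLabel, List.getD_eq_getElem?_getD, ← hp]
    | cup x =>
      obtain ⟨a, rfl, rfl⟩ := h
      rw [Elem.harmonic_cup_iff]
      simp [portLabel, List.getD_eq_getElem?_getD, ← hp]
    | cap x =>
      obtain ⟨a, rfl, rfl⟩ := h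
      rw [Elem.harmonic_cap_iff]
      simp [portLabel, List.getD_eq_getElem?_getD, ← hp]

theorem HarmonicOn.wordRel {s : R} (hs : s * s = 0) {o o' : List Dir} {w : List Slice}
    (hw : IsTangle o w o') {L : Point → R} (h : HarmonicOn (twist s) w L) :
    WordRel s w ((List.range o.length).map fun k => L (0, k))
      ((List.range o'.length).map fun k => L (w.length, k)) := by
  induction w generalizing o L with
  | nil => cases hw; rfl
  | cons σ w ih =>
    obtain ⟨rfl, hw⟩ := hw
    refine ⟨_, Slice.Harmonic.rel hs (h 0 σ rfl), ?_⟩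
    exact ih (L := fun p => L (p.1 + 1, p.2)) hw fun t τ ht => by
      have := h (t + 1) τ ht
      convert this using 3 with P
      cases P <;> rfl

theorem WordRel.exists_harmonicOn {s : R} (hs : s * s = 0) {w : List Slice} {f g : List R}
    (h : WordRel s w f g) : ∃ L : Point → R, HarmonicOn (twist s) w L ∧
      (∀ k, L (0, k) = f.getD k 0) ∧ ∀ k, L (w.length, k) = g.getD k 0 := by
  induction w generalizing f with
  | nil =>
    cases h
    exact ⟨fun p => g.getD p.2 0, by intro t σ h; simp at h, fun _ => rfl, fun _ => rfl⟩
  | cons σ w ih =>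
    obtain ⟨k, hk, h⟩ := h
    obtain ⟨L, hL, h₀, h₁⟩ := ih h
    refine ⟨fun p => match p with
      | (0, k) => f.getD k 0
      | (t + 1, k) => L (t, k), ?_, fun _ => rfl, h₁⟩
    intro t τ ht
    cases t with
    | zero =>
      obtain rfl : σ = τ := by simpa using ht
      convert hk.harmonic hs using 2 with P
      cases P with
      | top k => rfl
      | bot k => exact h₀ k
    | succ t =>
      convert hL t τ (by simpa using ht) using 2 with P
      cases P <;> rfl

theorem HarmonicOn.sub {W : BallModel R} {w : List Slice} {L L' : Point → R}
    (h : HarmonicOn W w L) (h' : HarmonicOn W w L') : HarmonicOn W w fun p => L p - L' p := by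
  intro t σ ht
  obtain ⟨h₁, h₂⟩ := h t σ ht
  obtain ⟨h₁', h₂'⟩ := h' t σ ht
  refine ⟨fun e he => congrArg₂ _ (h₁ e he) (h₁' e he), ?_⟩
  generalize σ.elem = E at *
  cases E with
  | cross c x y =>
    exact ⟨by linear_combination h₂.1 - h₂'.1, by linear_combination h₂.2 - h₂'.2⟩
  | cup x => exact fun e he => congrArg₂ _ (h₂ e he) (h₂' e he)
  | cap x => exact fun e he => congrArg₂ _ (h₂ e he) (h₂' e he)

theorem HarmonicOn.sum_mul {W : BallModel R} {w : List Slice} {ι : Type*} [Fintype ι]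
    {L : ι → Point → R} (h : ∀ j, HarmonicOn W w (L j)) (c : ι → R) :
    HarmonicOn W w fun p => ∑ j, L j p * c j := by
  intro t σ ht
  refine ⟨fun e he => Finset.sum_congr rfl fun j _ => congrArg (· * c j) ((h j t σ ht).1 e he), ?_⟩
  have h₂ := fun j => (h j t σ ht).2
  generalize σ.elem = E at *
  cases E with
  | cross _ x y =>
    simp only [Elem.Harmonic, Finset.mul_sum, ← Finset.sum_add_distrib]
    exact ⟨Finset.sum_congr rfl fun j _ => by linear_combination c j * (h₂ j).1,
      Finset.sum_congr rfl fun j _ => by linear_combination c j * (h₂ j).2⟩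
  | cup x => exact fun e he => Finset.sum_congr rfl fun j _ => congrArg (· * c j) (h₂ j e he)
  | cap x => exact fun e he => Finset.sum_congr rfl fun j _ => congrArg (· * c j) (h₂ j e he)

/-! ### Steps at the points of a diagram -/

section Diagram

variable {n : ℕ} (D : Diagram n)

theorem IsTangle.ballStep_sideArc {W : BallModel R} {o o' : List Dir} {w : List Slice}
    (hw : IsTangle o w o') {t : ℕ} {σ : Slice} (ht : w[t]? = some σ) {e : Port × Port}
    (he : e ∈ σ.sideArcs) (q : Point) (x : R) :
    BallStep W w (e.1.place t) q x ↔ q = e.2.place t ∧ x = 1 := by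
  rw [hw.ballStep_iff ht (Slice.isStart_isEnd_of_mem_arcs (List.mem_append_left _ he)).1]
  simp [Slice.mem_ballMoves_of_sideArc he, and_comm]

theorem IsTangle.ballStep_elemArc {W : BallModel R} {o o' : List Dir} {w : List Slice}
    (hw : IsTangle o w o') {t : ℕ} {σ : Slice} (ht : w[t]? = some σ) {e : Port × Port}
    (he : e ∈ σ.elem.arcs σ.left.length) (q : Point) (x : R) :
    BallStep W w (e.1.place t) q x ↔
      ∃ Q, (e.1, Q, x) ∈ σ.elem.ballMoves W σ.left.length ∧ q = Q.place t := by
  rw [hw.ballStep_iff ht (Slice.isStart_isEnd_of_mem_arcs (List.mem_append_right _ he)).1]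
  simp only [Slice.mem_ballMoves_of_elemArc he]

theorem IsTangle.ballStep_firstStrand {W : BallModel R} {o o' : List Dir} {w : List Slice}
    (hw : IsTangle o w o') {t : ℕ} {u v : List Dir} {c : Crossing} {x y : Dir}
    (ht : w[t]? = some ⟨u, .cross c x y, v⟩) (q : Point) (z : R) :
    BallStep W w ((firstStrand u.length x).1.place t) q z ↔
      (q = (firstStrand u.length x).2.place t ∧ z = 1 - W.jump c x y true) ∨
      (q = (secondStrand u.length y).2.place t ∧ z = W.jump c x y true) := by
  rw [hw.ballStep_elemArc ht (e := firstStrand u.length x) (by simp [Elem.arcs])]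
  have h := (firstStrand_ne_secondStrand u.length x y).1
  simp only [Elem.ballMoves, List.mem_cons, List.not_mem_nil, or_false, Prod.mk.injEq, true_and,
    h, false_and]
  constructor
  · rintro ⟨Q, ⟨rfl, rfl⟩ | ⟨rfl, rfl⟩, rfl⟩
    exacts [.inl ⟨rfl, rfl⟩, .inr ⟨rfl, rfl⟩]
  · rintro (⟨rfl, rfl⟩ | ⟨rfl, rfl⟩)
    exacts [⟨_, .inl ⟨rfl, rfl⟩, rfl⟩, ⟨_, .inr ⟨rfl, rfl⟩, rfl⟩]

theorem IsTangle.ballStep_secondStrand {W : BallModel R} {o o' : List Dir} {w : List Slice}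
    (hw : IsTangle o w o') {t : ℕ} {u v : List Dir} {c : Crossing} {x y : Dir}
    (ht : w[t]? = some ⟨u, .cross c x y, v⟩) (q : Point) (z : R) :
    BallStep W w ((secondStrand u.length y).1.place t) q z ↔
      (q = (secondStrand u.length y).2.place t ∧ z = 1 - W.jump c x y false) ∨
      (q = (firstStrand u.length x).2.place t ∧ z = W.jump c x y false) := by
  rw [hw.ballStep_elemArc ht (e := secondStrand u.length y) (by simp [Elem.arcs])]
  have h := (firstStrand_ne_secondStrand u.length x y).1.symm
  simp only [Elem.ballMoves, List.mem_cons, List.not_mem_nil, or_false, Prod.mk.injEq, true_and,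
    h, false_and, false_or]
  constructor
  · rintro ⟨Q, ⟨rfl, rfl⟩ | ⟨rfl, rfl⟩, rfl⟩
    exacts [.inl ⟨rfl, rfl⟩, .inr ⟨rfl, rfl⟩]
  · rintro (⟨rfl, rfl⟩ | ⟨rfl, rfl⟩)
    exacts [⟨_, .inl ⟨rfl, rfl⟩, rfl⟩, ⟨_, .inr ⟨rfl, rfl⟩, rfl⟩]

theorem IsTangle.ballStep_extremum {W : BallModel R} {o o' : List Dir} {w : List Slice}
    (hw : IsTangle o w o') {t : ℕ} {σ : Slice} (ht : w[t]? = some σ) {x : Dir}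
    (hx : σ.elem = .cup x ∨ σ.elem = .cap x) {e : Port × Port}
    (he : e ∈ σ.elem.arcs σ.left.length) (q : Point) (z : R) :
    BallStep W w (e.1.place t) q z ↔ q = e.2.place t ∧ z = 1 := by
  rw [hw.ballStep_elemArc ht he]
  have : ∀ Q, (e.1, Q, z) ∈ σ.elem.ballMoves W σ.left.length ↔ Q = e.2 ∧ z = 1 := by
    intro Q
    rcases hx with hx | hx <;> rw [hx] at he ⊢ <;>
      simp only [Elem.arcs, List.mem_cons, List.not_mem_nil, or_false] at he <;> subst he <;>
      simp [Elem.ballMoves, Elem.arcs]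
  simp [this, and_comm]

/-- A point of a diagram is an end point of a string, or it has one way out, or it lies in front
of a crossing, where the ball goes straight on to `q` or jumps to `r`. -/
theorem Diagram.point_cases {s : R} {p : Point} (hp : IsPoint (strings n) D.word p) :
    (∃ i < n, p = (D.word.length, i)) ∨
    (∃ q, StraightStep D.word p q ∧
      (∀ q' x, BallStep (twist s) D.word p q' x ↔ q' = q ∧ x = 1) ∧
      ∀ L, HarmonicOn (twist s) D.word L → L p = L q) ∨
    (∃ (q r : Point) (ε : ℤ), StraightStep D.word p q ∧ IsPoint (strings n) D.word r ∧ q ≠ r ∧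
      (∀ q' x, BallStep (twist s) D.word p q' x ↔
        (q' = q ∧ x = 1 - ε * s) ∨ (q' = r ∧ x = ε * s)) ∧
      ∀ L, HarmonicOn (twist s) D.word L → L p = (1 - ε * s) * L q + ε * s * L r) := by
  rcases D.exists_start hp with ⟨t, σ, P, ht, hP, rfl⟩ | h
  · refine .inr ?_
    obtain ⟨Q, hQ⟩ := Slice.exists_arc_of_isStart hP
    have hstep : StraightStep D.word (P.place t) (Q.place t) := ⟨t, σ, ht, _, hQ, rfl, rfl⟩
    rcases List.mem_append.1 hQ with h | h
    · exact .inl ⟨_, hstep, D.isTangle.ballStep_sideArc ht h, fun L hL => (hL t σ ht).1 _ h⟩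
    · obtain ⟨u, E, v⟩ := σ
      have hpt : ∀ {S : Port}, (Slice.mk u E v).IsEnd S → IsPoint (strings n) D.word (S.place t) :=
        fun hS => isPoint_iff.2 ⟨_, D.isTangle.dirAt_end ht hS⟩
      cases E with
      | cross c x y =>
        have h₁ := (Slice.isStart_isEnd_of_mem_arcs (σ := ⟨u, .cross c x y, v⟩)
          (e := firstStrand u.length x) (List.mem_append_right _ (by simp [Elem.arcs]))).2
        have h₂ := (Slice.isStart_isEnd_of_mem_arcs (σ := ⟨u, .cross c x y, v⟩)
          (e := secondStrand u.length y) (List.mem_append_right _ (by simp [Elem.arcs]))).2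
        have hne := (firstStrand_ne_secondStrand u.length x y).2
        simp only [Elem.arcs, List.mem_cons, List.not_mem_nil, or_false] at h
        rcases h with h | h
        · obtain ⟨ε, hε⟩ := exists_jump_twist s c x y true
          obtain ⟨rfl, rfl⟩ := Prod.mk.inj h
          refine .inr ⟨_, _, ε, hstep, hpt h₂, fun e => hne (Port.place_injective t e), ?_,
            fun L hL => ?_⟩
          · rw [← hε]; exact D.isTangle.ballStep_firstStrand ht
          · rw [← hε]; exact (hL t _ ht).2.1
        · obtain ⟨ε, hε⟩ := exists_jump_twist s c x y false
          obtain ⟨rfl, rfl⟩ := Prod.mk.inj h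
          refine .inr ⟨_, _, ε, hstep, hpt h₁, fun e => hne (Port.place_injective t e).symm, ?_,
            fun L hL => ?_⟩
          · rw [← hε]; exact D.isTangle.ballStep_secondStrand ht
          · rw [← hε]; exact (hL t _ ht).2.2
      | cup x =>
        exact .inl ⟨_, hstep, D.isTangle.ballStep_extremum ht (.inl rfl) h,
          fun L hL => (hL t _ ht).2 _ h⟩
      | cap x =>
        exact .inl ⟨_, hstep, D.isTangle.ballStep_extremum ht (.inr rfl) h,
          fun L hL => (hL t _ ht).2 _ h⟩
  · exact .inl h

end Diagram

section Diagram

variable {n : ℕ} (D : Diagram n) {s : R}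

/-! ### The ball matrix as a solution of the mean value property -/

/-- Uniqueness: a harmonic labelling that vanishes at the ends of the strings vanishes.
Multiplied by `s` it is constant along the strings, hence `s * L = 0`; so the terms for the jumps
vanish, and `L` itself is constant along the strings. -/
theorem HarmonicOn.eq_zero (hs : s * s = 0) {L : Point → R} (hL : HarmonicOn (twist s) D.word L)
    (h₀ : ∀ i < n, L (D.word.length, i) = 0) {p : Point} (hp : IsPoint (strings n) D.word p) :
    L p = 0 := by
  have h₁ : ∀ p, IsPoint (strings n) D.word p → s * L p = 0 := by
    refine D.straightStep_induction fun p hp ih => ?_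
    rcases D.point_cases (s := s) hp with ⟨i, hi, rfl⟩ | ⟨q, hq, -, h⟩ | ⟨q, r, ε, hq, -, -, -, h⟩
    · rw [h₀ i hi, mul_zero]
    · rw [h L hL, ih q hq]
    · rw [h L hL]
      linear_combination ih q hq + (ε * L r - ε * L q) * hs
  revert p hp
  refine @(D.straightStep_induction fun p hp ih => ?_)
  rcases D.point_cases (s := s) hp with ⟨i, hi, rfl⟩ | ⟨q, hq, -, h⟩ | ⟨q, r, ε, hq, hr, -, -, h⟩
  · exact h₀ i hi
  · rw [h L hL, ih q hq]
  · rw [h L hL, ih q hq]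
    linear_combination ε * h₁ r hr

theorem Diagram.ne_bot_of_ballStep {W : BallModel R} {p q : Point} {x : R}
    (h : BallStep W D.word p q x) {j : ℕ} (hj : j < n) : p ≠ (D.word.length, j) := by
  rintro rfl
  exact D.not_ballStep_bot hj h

theorem Diagram.subsingleton_path_bot {W : BallModel R} {i : ℕ} (hi : i < n) {e : Point} :
    Subsingleton (Path W D.word (D.word.length, i) e) := by
  refine ⟨fun γ γ' => ?_⟩
  cases γ with
  | nil => exact (Path.eq_nil (fun _ _ => D.not_ballStep_bot hi) γ').symm
  | cons x h γ => exact absurd h (D.not_ballStep_bot hi)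

/-- The walks that could still follow a jump: they never jump at a virtual crossing themselves, so
there is at most the one along the string. -/
theorem Diagram.finite_mul_weight_ne_zero (hs : s * s = 0) {j : ℕ} (hj : j < n) :
    ∀ p, IsPoint (strings n) D.word p →
      {γ : Path (twist s) D.word p (D.word.length, j) | s * γ.weight ≠ 0}.Finite := by
  refine D.straightStep_induction fun p hp ih => ?_
  rcases D.point_cases (s := s) hp with ⟨i, hi, rfl⟩ | ⟨q, hq, h, -⟩ | ⟨q, r, ε, hq, -, -, h, -⟩
  · have := D.subsingleton_path_bot (W := twist s) hi (e := (D.word.length, j))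
    exact Set.toFinite _
  · refine Path.finite_weight_ne_zero_of_two (q := q) (a := 1) (r := q) (b := 1)
      (fun q' x h' => .inl ((h q' x).1 h')) (D.ne_bot_of_ballStep ((h q 1).2 ⟨rfl, rfl⟩) hj) s ?_ ?_
    all_goals simpa using ih q hq
  · refine Path.finite_weight_ne_zero_of_two (fun q' x => (h q' x).1)
      (D.ne_bot_of_ballStep ((h q _).2 (.inl ⟨rfl, rfl⟩)) hj) s ?_ ?_
    · convert ih q hq using 4 with γ
      linear_combination -(ε * γ.weight) * hs
    · convert Set.finite_empty
      ext γ
      simp only [Set.mem_ofPred_eq, Set.mem_empty_iff_false, iff_false, not_not]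
      linear_combination (ε * γ.weight) * hs

theorem Diagram.finite_weight_ne_zero (hs : s * s = 0) {j : ℕ} (hj : j < n) :
    ∀ p, IsPoint (strings n) D.word p →
      {γ : Path (twist s) D.word p (D.word.length, j) | γ.weight ≠ 0}.Finite := by
  refine D.straightStep_induction fun p hp ih => ?_
  rcases D.point_cases (s := s) hp with ⟨i, hi, rfl⟩ | ⟨q, hq, h, -⟩ | ⟨q, r, ε, hq, hr, -, h, -⟩
  · have := D.subsingleton_path_bot (W := twist s) hi (e := (D.word.length, j))
    exact Set.toFinite _
  · have := Path.finite_weight_ne_zero_of_two (q := q) (a := 1) (r := q) (b := 1)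
      (fun q' x h' => .inl ((h q' x).1 h')) (D.ne_bot_of_ballStep ((h q 1).2 ⟨rfl, rfl⟩) hj) 1
      (by simpa using ih q hq) (by simpa using ih q hq)
    simpa using this
  · have := Path.finite_weight_ne_zero_of_two (fun q' x => (h q' x).1)
      (D.ne_bot_of_ballStep ((h q _).2 (.inl ⟨rfl, rfl⟩)) hj) 1
      ((ih q hq).subset fun γ hγ h0 => hγ (by simp [h0]))
      -- the weight of a jump is a multiple of `s`
      ((D.finite_mul_weight_ne_zero hs hj r hr).subset fun γ hγ h0 => hγ
        (by linear_combination ε * h0))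
    simpa using this

theorem Diagram.pathSum_bot {W : BallModel R} {i j : ℕ} (hi : i < n) :
    pathSum W D.word (D.word.length, i) (D.word.length, j) = if i = j then 1 else 0 := by
  split_ifs with h
  · subst h; exact pathSum_self fun _ _ => D.not_ballStep_bot hi
  · exact pathSum_eq_zero (fun _ _ => D.not_ballStep_bot hi) (by simpa using h)

theorem Diagram.harmonicOn_pathSum (hs : s * s = 0) {j : ℕ} (hj : j < n) :
    HarmonicOn (twist s) D.word fun p => pathSum (twist s) D.word p (D.word.length, j) := by
  intro t σ ht
  have hpt : ∀ {e}, e ∈ σ.arcs → IsPoint (strings n) D.word (e.2.place t) := fun he =>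
    isPoint_iff.2 ⟨_, D.isTangle.dirAt_end ht (Slice.isStart_isEnd_of_mem_arcs he).2⟩
  have hne : ∀ {e}, e ∈ σ.arcs → e.1.place t ≠ (D.word.length, j) := fun he =>
    D.place_ne_bot ht (Slice.isStart_isEnd_of_mem_arcs he).1 hj
  refine ⟨fun e he => pathSum_of_unique (D.isTangle.ballStep_sideArc ht he)
    (hne (List.mem_append_left _ he)), ?_⟩
  obtain ⟨u, E, v⟩ := σ
  cases E with
  | cross c x y =>
    have h₁ : firstStrand u.length x ∈ (Slice.mk u (.cross c x y) v).arcs :=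
      List.mem_append_right _ (by simp [Elem.arcs])
    have h₂ : secondStrand u.length y ∈ (Slice.mk u (.cross c x y) v).arcs :=
      List.mem_append_right _ (by simp [Elem.arcs])
    have hst := (firstStrand_ne_secondStrand u.length x y).2
    exact ⟨pathSum_of_two (D.isTangle.ballStep_firstStrand ht)
        (fun e => hst (Port.place_injective t e)) (hne h₁)
        (D.finite_weight_ne_zero hs hj _ (hpt h₁)) (D.finite_weight_ne_zero hs hj _ (hpt h₂)),
      pathSum_of_two (D.isTangle.ballStep_secondStrand ht)
        (fun e => hst (Port.place_injective t e).symm) (hne h₂)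
        (D.finite_weight_ne_zero hs hj _ (hpt h₂)) (D.finite_weight_ne_zero hs hj _ (hpt h₁))⟩
  | cup x =>
    exact fun e he => pathSum_of_unique (D.isTangle.ballStep_extremum ht (.inl rfl) he)
      (hne (List.mem_append_right _ he))
  | cap x =>
    exact fun e he => pathSum_of_unique (D.isTangle.ballStep_extremum ht (.inr rfl) he)
      (hne (List.mem_append_right _ he))

theorem Diagram.isPoint_top {i : ℕ} (hi : i < n) : IsPoint (strings n) D.word (0, i) :=
  isPoint_iff.2 ⟨_, D.dirAt_top hi⟩

/-! ### Matrix and labelling relation -/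

open Matrix in
/-- The labels that extend over the whole diagram form the graph of its matrix. -/
theorem Diagram.wordRel_iff (hs : s * s = 0) (f g : Fin n → R) :
    WordRel s D.word (List.ofFn f) (List.ofFn g) ↔ f = D.ballMatrix (twist s) *ᵥ g := by
  let L : Point → R := fun p => ∑ j : Fin n, pathSum (twist s) D.word p (D.word.length, j) * g j
  have hL : HarmonicOn (twist s) D.word L :=
    HarmonicOn.sum_mul (fun j : Fin n => D.harmonicOn_pathSum hs j.2) g
  have hbot : ∀ i : Fin n, L (D.word.length, i) = g i := fun i => by
    simp [L, D.pathSum_bot i.2, Fin.val_inj]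
  have htop : ∀ i : Fin n, L (0, i) = (D.ballMatrix (twist s) *ᵥ g) i := fun i => rfl
  have hlist : ∀ (l : ℕ) (v : Fin n → R), (∀ i : Fin n, L (l, i) = v i) →
      (List.range (strings n).length).map (fun k => L (l, k)) = List.ofFn v := by
    intro l v hv
    apply List.ext_getElem
    · simp [strings]
    · intro i h _
      have hi : i < n := by simpa [strings] using h
      simpa using hv ⟨i, hi⟩
  constructor
  · intro h
    obtain ⟨L', hL', h₀, h₁⟩ := h.exists_harmonicOn hs
    funext i
    rw [← htop, ← sub_eq_zero]
    have := (hL'.sub hL).eq_zero D hs (fun k hk => ?_) (D.isPoint_top i.2)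
    · simpa [h₀] using this
    · rw [h₁, hbot ⟨k, hk⟩]; simp [hk]
  · rintro rfl
    have := hL.wordRel hs D.isTangle
    rwa [hlist _ _ hbot, hlist _ _ htop] at this

open Matrix in
theorem Diagram.ballMatrix_eq_of_wordRel (hs : s * s = 0) (A : Matrix (Fin n) (Fin n) R)
    (h : ∀ g, WordRel s D.word (List.ofFn (A *ᵥ g)) (List.ofFn g)) :
    D.ballMatrix (twist s) = A := by
  refine Matrix.mulVec_injective (funext fun g => ?_)
  exact ((D.wordRel_iff hs _ _).1 (h g)).symm

theorem Diagram.ballMatrix_eq_of_move (hs : s * s = 0) {D D' : Diagram n} (h : Move D D') :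
    D.ballMatrix (twist s) = D'.ballMatrix (twist s) := by
  symm
  refine D'.ballMatrix_eq_of_wordRel hs _ fun g => ?_
  have hD := (D.wordRel_iff hs _ g).2 rfl
  obtain ⟨w, w', l, l', a, b, hl, e, e'⟩ := h
  rw [e, WordRel.append_iff] at hD
  obtain ⟨k, hD, hw'⟩ := hD
  obtain ⟨k', hw, hD⟩ := WordRel.append_iff.1 hD
  obtain ⟨u, v, f, f', hu, hv, rfl, rfl, hr⟩ := WordRel.of_pad hl.ne_nil hD
  rw [e', WordRel.append_iff]
  exact ⟨_, WordRel.append_iff.2 ⟨_, hw, WordRel.pad hu hv (hl.wordRel hs hr)⟩, hw'⟩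

theorem Diagram.ballMatrix_mul (hs : s * s = 0) (D D' : Diagram n) :
    (D * D').ballMatrix (twist s) = D.ballMatrix (twist s) * D'.ballMatrix (twist s) := by
  refine Diagram.ballMatrix_eq_of_wordRel _ hs _ fun g => ?_
  rw [Diagram.word_mul, WordRel.append_iff]
  refine ⟨_, (D.wordRel_iff hs _ _).2 ?_, (D'.wordRel_iff hs _ _).2 rfl⟩
  rw [Matrix.mulVec_mulVec]

theorem Diagram.ballMatrix_one (hs : s * s = 0) :
    (1 : Diagram n).ballMatrix (twist s) = 1 := by
  refine Diagram.ballMatrix_eq_of_wordRel _ hs _ fun g => ?_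
  rw [Matrix.one_mulVec]
  rfl

/-- The representation of the monoid of virtual string links given by the ball matrices. -/
noncomputable def ballRepresentation (n : ℕ) (hs : s * s = 0) :
    VirtualStringLink n →* Matrix (Fin n) (Fin n) R :=
  (equivalence n).lift
    { toFun := fun D => D.ballMatrix (twist s)
      map_one' := Diagram.ballMatrix_one hs
      map_mul' := Diagram.ballMatrix_mul hs } <| by
    intro D D' h
    have h' : Relation.EqvGen Move D D' := h
    clear h
    induction h' with
    | rel _ _ h => exact Diagram.ballMatrix_eq_of_move hs h
    | refl => rfl
    | symm _ _ _ ih => exact ih.symm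
    | trans _ _ _ _ _ ih ih' => exact ih.trans ih'

end Diagram

/-! ### Coefficients in `ℤ[s]/(s²)` -/

theorem sVar_mul_sVar : sVar * sVar = 0 := by
  have h : AdjoinRoot.mk ((X : ℤ[X]) ^ 2) (X ^ 2) = 0 := AdjoinRoot.mk_self
  rw [← pow_two]
  rwa [map_pow, AdjoinRoot.mk_X] at h

theorem Zs.exists_eq (z : Zs) : ∃ a b : ℤ, z = a * sVar + b := by
  induction z using AdjoinRoot.induction_on with
  | ih p =>
    refine ⟨p.coeff 1, p.coeff 0, ?_⟩
    have h : AdjoinRoot.mk ((X : ℤ[X]) ^ 2) (p.divX.divX * X ^ 2) = 0 := by simp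
    have e : p = p.divX.divX * X ^ 2 + (C (p.coeff 1) * X + C (p.coeff 0)) := by
      conv_lhs => rw [← p.divX_mul_X_add, ← p.divX.divX_mul_X_add, Polynomial.coeff_divX]
      ring
    conv_lhs => rw [e, map_add, h]
    simp

/-- Modulo `s` a ball never jumps, so it reaches a given end with weight `0` or `1`. -/
theorem Diagram.exists_pathSum_eq {n : ℕ} (D : Diagram n) {j : ℕ} (hj : j < n) :
    ∀ p, IsPoint (strings n) D.word p → ∃ a b : ℤ, (b = 0 ∨ b = 1) ∧
      pathSum (twist sVar) D.word p (D.word.length, j) = a * sVar + b := by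
  have hL := D.harmonicOn_pathSum sVar_mul_sVar hj
  refine D.straightStep_induction fun p hp ih => ?_
  rcases D.point_cases (s := sVar) hp with ⟨i, hi, rfl⟩ | ⟨q, hq, -, h⟩ | ⟨q, r, ε, hq, -, -, -, h⟩
  · rw [D.pathSum_bot hi]
    split_ifs
    · exact ⟨0, 1, .inr rfl, by simp⟩
    · exact ⟨0, 0, .inl rfl, by simp⟩
  · rw [h _ hL]; exact ih q hq
  · obtain ⟨a, b, hb, hF⟩ := ih q hq
    obtain ⟨a', b', h'⟩ := Zs.exists_eq (pathSum (twist sVar) D.word r (D.word.length, j))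
    refine ⟨a + ε * (b' - b), b, hb, ?_⟩
    rw [h _ hL]
    rw [hF, h']
    push_cast
    linear_combination (ε * a' - ε * a : Zs) * sVar_mul_sVar

end VStringLink

theorem theorem2p1 (n : ℕ) :
    (∀ (D : VStringLink.Diagram n) (i j : Fin n),
      {γ : D.LanePath VStringLink.model i j | γ.weight ≠ 0}.Finite ∧
      ∃ a b : ℤ, (b = 0 ∨ b = 1) ∧
        D.M i j = (a : VStringLink.Zs) * VStringLink.sVar + (b : VStringLink.Zs)) ∧
    (∀ D D' : VStringLink.Diagram n, VStringLink.Move D D' → D.M = D'.M) ∧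
    (∃ ρ : VStringLink.VirtualStringLink n →* Matrix (Fin n) (Fin n) VStringLink.Zs,
      ∀ D : VStringLink.Diagram n, ρ (VStringLink.VirtualStringLink.mk D) = D.M) := by
  refine ⟨fun D i j => ⟨?_, ?_⟩, fun D D' h => ?_, ?_⟩
  · exact D.finite_weight_ne_zero VStringLink.sVar_mul_sVar j.2 _ (D.isPoint_top i.2)
  · exact D.exists_pathSum_eq j.2 _ (D.isPoint_top i.2)
  · exact VStringLink.Diagram.ballMatrix_eq_of_move VStringLink.sVar_mul_sVar h
  · exact ⟨VStringLink.ballRepresentation n VStringLink.sVar_mul_sVar, fun D => rfl⟩
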